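/- Let $(\Omega,\mathcal F,\mathbb P)$ be a probability space and $(x^k)_{k\ge 0}$ random vectors in $\mathbb R^d$ with $x^0$ deterministic; put $\mathcal F_k=\sigma(x^0,\dots,x^k)$. Let $S\subseteq\mathbb R^d$ be closed, let $g,h:S\to\mathbb R$ be continuous with $g\ge 0$ and $h^*:=\inf_S h>-\infty$, let $c_1,c_2,c_3>0$ with $c_3>c_2$, and let $(\alpha_k)_{k\ge0}$ be positive numbers. Assume that $x^k\in S$ for all $k\ge0$ and that, for all $k\ge 0$, $$h(x^{k+1})\le h(x^k)-\frac{c_1}{\alpha_k}\|x^{k+1}-x^k\|^2,\qquad \mathbb E\big[\|x^{k+1}-x^k\|^2\,\big|\,\mathcal F_k\big]\ge c_2\alpha_k^2\,g(x^k)\ \text{a.s.},\qquad \|x^{k+1}-x^k\|^2\le c_3\alpha_k^2\,g(x^k).$$ Let $\tau>0$ and let $\phi_S:[0,\tau)\to[0,\infty)$ be continuous and non-decreasing, with $\phi_S(0)=0$ and $\phi_S>0$ on $(0,\tau)$, such that $0\le h(x)-h^*<\tau$ and $\phi_S(h(x)-h^*)\le g(x)$ for all $x\in S$. A function $f$ on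 $[0,\tau)$ is called integrable near $0$ if it is integrable on $[0,\tau']$ for some $\tau'\in(0,\tau)$. Assume that $1/\phi_S$ is not integrable near $0$. Fix any $t_0\in(0,\tau)$ and define $\Psi_S:[0,\tau)\to(-\infty,+\infty]$ by $\Psi_S(t)=\int_t^{t_0}\frac{ds}{\phi_S(s)}$, so that $\Psi_S(0)=+\infty$ and $\Psi_S$ is strictly decreasing; let $\Psi_S^{-1}$ be its inverse, defined on the range of $\Psi_S$ (with $\Psi_S^{-1}(+\infty)=0$). If $1/\sqrt{\phi_S}$ is integrable near $0$, define $\Phi_S(t)=\int_0^t\frac{ds}{\sqrt{\phi_S(s)}}$ for $t\in[0,\tau)$. Put $p=\frac{c_2}{2c_3-c_2}$. Assume moreover that there is $\bar\alpha>0$ with $\alpha_k\le\bar\alpha$ for all $k$, and that $\sum_{k}\alpha_k=+\infty$. (i) For all $k\ge 1$, $$\mathbb E[h(x^k)-h^*]\le \exp\Big(-\frac{p^2}{2\bar\alpha}\sum_{i=0}^{k-1}\alpha_i\Big)(h(x^0)-h^*)+\Psi_S^{-1}\Big(\Psi_S(h(x^0)-h^*)+\frac{c_1c_2p}{4}\sum_{i=0}^{k-1}\alpha_i\Big),$$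 the argument of $\Psi_S^{-1}$ being in its domain. If in addition $1/\sqrt{\phi_S}$ is integrable near $0$, then there is a random vector $x^*$ such that $x^k\to x^*$ almost surely and in $L^1$, $x^*\in\operatorname{argmin}_{x\in S}h(x)$ almost surely, and $$\mathbb E\|x^k-x^*\|\le\frac{\sqrt{c_3}}{c_1c_2}\,\Phi_S\big(\mathbb E[h(x^k)-h^*]\big)\qquad\text{for all }k\ge 0.$$ (ii) Suppose in addition that $\sum_{k\ge0}\Big(\frac{\alpha_k}{\sum_{j=0}^k\alpha_j}\Big)^2<\infty$. Then there is an almost surely finite random index $K_2$ such that, almost surely, for all $k\ge K_2$, the number $\frac{c_1c_2p}{3}\sum_{i=0}^{k-1}\alpha_i$ is in the domain of $\Psi_S^{-1}$ and $$h(x^k)-h^*\le\Psi_S^{-1}\Big(\frac{c_1c_2p}{3}\sum_{i=0}^{k-1}\alpha_i\Big).$$ If moreover $1/\sqrt{\phi_S}$ is integrable near $0$, then, for the limit $x^*$ of (i), there is an almost surely finite random index $K_3$ such that, almost surely, for all $k\ge K_3$, the number $\frac{c_1c_2p}{4}\sum_{i=0}^{k-1}\alpha_i$ is in the domain of $\Psi_S^{-1}$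 and $$\|x^k-x^*\|\le\frac{4}{c_1\sqrt{c_2p}}\,\Phi_S\Big(\Psi_S^{-1}\Big(\frac{c_1c_2p}{4}\sum_{i=0}^{k-1}\alpha_i\Big)\Big).$$ -/

import Mathlib

open MeasureTheory ProbabilityTheory Filter Topology Set

/-- `f` is integrable near `0`, for a function `f` on `[0, τ)`. -/
def IntegrableNearZero (τ : ℝ) (f : ℝ → ℝ) : Prop :=
  ∃ τ' ∈ Ioo (0 : ℝ) τ, IntegrableOn f (Icc 0 τ')

/-- The inverse smoothing function `Ψ(t) = ∫_t^{t₀} ds / φ(s)`, an extended real number. For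
`t ≤ t₀` the second integral vanishes and the value lies in `[0, ∞]`; for `t > t₀` the first one
vanishes and the value is minus the integral from `t₀` to `t`. -/
noncomputable def invSmoothing (φ : ℝ → ℝ) (t₀ t : ℝ) : EReal :=
  ((∫⁻ s in Ioc t t₀, ENNReal.ofReal (1 / φ s) : ENNReal) : EReal) -
    ((∫⁻ s in Ioc t₀ t, ENNReal.ofReal (1 / φ s) : ENNReal) : EReal)

/-- The domain of `Ψ⁻¹`, i.e. the range of `Ψ` on `[0, τ)`. -/
def invSmoothingRange (φ : ℝ → ℝ) (τ t₀ : ℝ) : Set EReal :=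
  invSmoothing φ t₀ '' Ico 0 τ

/-- The inverse of `Ψ : [0, τ) → (-∞, ∞]`; it is meaningful on `invSmoothingRange φ τ t₀`. -/
noncomputable def invSmoothingInv (φ : ℝ → ℝ) (τ t₀ : ℝ) : EReal → ℝ :=
  Function.invFunOn (invSmoothing φ t₀) (Ico 0 τ)

/-- The desingularization function `Φ(t) = ∫_0^t ds / √φ(s)`. -/
noncomputable def desingularization (φ : ℝ → ℝ) (t : ℝ) : ℝ :=
  ∫ s in (0 : ℝ)..t, 1 / √(φ s)

/-- The optimal value `h* = inf_{x ∈ S} h(x)`. -/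
noncomputable def optValue {E : Type*} (h : E → ℝ) (S : Set E) : ℝ := sInf (h '' S)

/-- Monotone randomized algorithms: the random iterates `x k` with deterministic initial value `x₀`
stay in the closed set `S` and satisfy the sufficient decrease and the step bounds with constants
`c₁, c₂, c₃` and step sizes `α`. The functions `g` and `h` only matter on `S`. The conditional
expectation is taken with respect to the filtration generated by the iterates. -/
structure IsMonotoneRandomizedAlgorithm {Ω : Type*} [MeasurableSpace Ω] (μ : Measure Ω) {d : ℕ}
    (x : ℕ → Ω → EuclideanSpace ℝ (Fin d)) (x₀ : EuclideanSpace ℝ (Fin d))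
    (S : Set (EuclideanSpace ℝ (Fin d))) (g h : EuclideanSpace ℝ (Fin d) → ℝ)
    (c₁ c₂ c₃ : ℝ) (α : ℕ → ℝ) : Prop where
  measurable_iterate : ∀ k, Measurable (x k)
  init : ∀ ω, x 0 ω = x₀
  isClosed : IsClosed S
  continuousOn_g : ContinuousOn g S
  continuousOn_h : ContinuousOn h S
  g_nonneg : ∀ y ∈ S, 0 ≤ g y
  bddBelow_h : BddBelow (h '' S)
  c₁_pos : 0 < c₁
  c₂_pos : 0 < c₂
  c₂_lt_c₃ : c₂ < c₃
  stepSize_pos : ∀ k, 0 < α k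
  decrease : ∀ k ω, h (x (k + 1) ω) ≤ h (x k ω) - c₁ / α k * ‖x (k + 1) ω - x k ω‖ ^ 2
  condExp_step_ge : ∀ k, ∀ᵐ ω ∂μ, c₂ * α k ^ 2 * g (x k ω) ≤
    (μ[fun ω' => ‖x (k + 1) ω' - x k ω'‖ ^ 2 |
      Filtration.natural x (fun i => (measurable_iterate i).stronglyMeasurable) k]) ω
  step_le : ∀ k ω, ‖x (k + 1) ω - x k ω‖ ^ 2 ≤ c₃ * α k ^ 2 * g (x k ω)
  mem : ∀ k ω, x k ω ∈ S

/-- Global error bound `φ (h x - h*) ≤ g x` on `S`; the function `φ` only matters on `[0, τ)`. -/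
structure IsGlobalErrorBound {d : ℕ} (S : Set (EuclideanSpace ℝ (Fin d)))
    (g h : EuclideanSpace ℝ (Fin d) → ℝ) (φ : ℝ → ℝ) (τ : ℝ) : Prop where
  τ_pos : 0 < τ
  error_bound : ∀ y ∈ S, φ (h y - optValue h S) ≤ g y
  continuousOn : ContinuousOn φ (Ico 0 τ)
  monotoneOn : MonotoneOn φ (Ico 0 τ)
  pos : ∀ t ∈ Ioo 0 τ, 0 < φ t
  map_zero : φ 0 = 0
  gap_mem : ∀ y ∈ S, h y - optValue h S ∈ Ico 0 τ

/-!
A good step is one whose squared length is at least half of its guaranteed conditional mean. Since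
the squared step is also at most `c₃ α² g`, a reverse Markov inequality
(`IsMonotoneRandomizedAlgorithm.le_condExp_goodStep`) shows that each step is good with conditional
probability at least `p = c₂ / (2 c₃ - c₂)`. A good step decreases the gap `h (x k) - h*` by at
least `c₁ c₂ α / 2 * φ (gap)`; as `φ` is non-decreasing, `Ψ (gap)` grows by at least `c₁ c₂ α / 2`
(`IsMonotoneRandomizedAlgorithm.invSmoothing_add_goodStep_le`). So the rates of the gap reduce to
lower bounds for the sum of the `α i` over the good steps `i < k`. A Chernoff bound based on
Hoeffding's lemma (`measureReal_weighted_sum_le`) shows that this sum is at most half of the lower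
bound `p ∑ α i` on its mean with probability at most `exp (-p² / (2 αbar) ∑ α i)`, which gives the
rate in expectation. By the Borel–Cantelli lemma along a subsequence, the sum eventually exceeds any
smaller fraction of `p ∑ α i` almost surely (`ae_eventually_mul_le_weighted_sum`), which gives the
almost sure rate.

For the iterates, the expected step length is at most `√c₃ / (c₁ c₂)` times the expected decrease of
`Φ (gap)` (`IsMonotoneRandomizedAlgorithm.integral_norm_step_le`). Hence the steps are almost surely
summable, and telescoping with Jensen's inequality for the concave function `Φ` gives the rate in
expectation. The almost sure rate is a deterministic consequence of the almost sure rate of the gap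
and of the sufficient decrease
(`IsErrorBoundFunction.sum_Ico_le_desingularization`).
-/

/-! ### The inverse smoothing function -/

/-- Functions `φ` on `[0, τ)` that can occur in a global error bound: continuous, non-decreasing,
zero at `0` and positive on `(0, τ)`. -/
structure IsErrorBoundFunction (φ : ℝ → ℝ) (τ : ℝ) : Prop where
  continuousOn : ContinuousOn φ (Ico 0 τ)
  monotoneOn : MonotoneOn φ (Ico 0 τ)
  pos : ∀ t ∈ Ioo 0 τ, 0 < φ t
  map_zero : φ 0 = 0

namespace IsErrorBoundFunction

variable {φ : ℝ → ℝ} {τ t₀ : ℝ}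

lemma continuousOn_one_div (H : IsErrorBoundFunction φ τ) :
    ContinuousOn (fun s => 1 / φ s) (Ioo 0 τ) :=
  continuousOn_const.div (H.continuousOn.mono Ioo_subset_Ico_self) fun t ht => (H.pos t ht).ne'

lemma continuousOn_one_div_sqrt (H : IsErrorBoundFunction φ τ) :
    ContinuousOn (fun s => 1 / √(φ s)) (Ioo 0 τ) :=
  continuousOn_const.div (H.continuousOn.mono Ioo_subset_Ico_self).sqrt
    fun t ht => (Real.sqrt_pos.2 (H.pos t ht)).ne'

lemma uIcc_subset_Ioo {a b : ℝ} (ha : a ∈ Ioo 0 τ) (hb : b ∈ Ioo 0 τ) :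
    uIcc a b ⊆ Ioo 0 τ :=
  ordConnected_Ioo.uIcc_subset ha hb

lemma intervalIntegrable (H : IsErrorBoundFunction φ τ) {a b : ℝ} (ha : a ∈ Ioo 0 τ)
    (hb : b ∈ Ioo 0 τ) : IntervalIntegrable (fun s => 1 / φ s) volume a b :=
  (H.continuousOn_one_div.mono (uIcc_subset_Ioo ha hb)).intervalIntegrable

lemma integral_le_smoothing_increment (H : IsErrorBoundFunction φ τ) {a b : ℝ} (ha : 0 < a)
    (hab : a ≤ b) (hb : b < τ) : (b - a) / φ b ≤ ∫ s in a..b, 1 / φ s := by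
  have h := intervalIntegral.integral_mono_on (f := fun _ => 1 / φ b) (g := fun s => 1 / φ s) hab
    intervalIntegrable_const (H.intervalIntegrable ⟨ha, hab.trans_lt hb⟩ ⟨ha.trans_le hab, hb⟩)
    fun s hs => one_div_le_one_div_of_le (H.pos s ⟨ha.trans_le hs.1, hs.2.trans_lt hb⟩)
      (H.monotoneOn ⟨(ha.trans_le hs.1).le, hs.2.trans_lt hb⟩ ⟨(ha.trans_le hab).le, hb⟩ hs.2)
  simpa [div_eq_mul_inv] using h

lemma invSmoothing_eq_coe (H : IsErrorBoundFunction φ τ) (ht₀ : t₀ ∈ Ioo 0 τ) {t : ℝ}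
    (ht : t ∈ Ioo 0 τ) : invSmoothing φ t₀ t = ((∫ s in t..t₀, 1 / φ s : ℝ) : EReal) := by
  have key : ∀ a ∈ Ioo 0 τ, ∀ b ∈ Ioo 0 τ, a ≤ b →
      ((∫⁻ s in Ioc a b, ENNReal.ofReal (1 / φ s) : ENNReal) : EReal) =
        ((∫ s in a..b, 1 / φ s : ℝ) : EReal) := by
    intro a ha b hb hab
    have hpos : ∀ s ∈ Ioc a b, 0 ≤ 1 / φ s := fun s hs =>
      one_div_nonneg.2 (H.pos s ⟨ha.1.trans hs.1, hs.2.trans_lt hb.2⟩).le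
    rw [← ofReal_integral_eq_lintegral_ofReal, intervalIntegral.integral_of_le hab,
      EReal.coe_ennreal_ofReal, max_eq_left (setIntegral_nonneg measurableSet_Ioc hpos)]
    · exact (intervalIntegrable_iff_integrableOn_Ioc_of_le hab).1 (H.intervalIntegrable ha hb)
    · exact (ae_restrict_mem measurableSet_Ioc).mono hpos
  unfold invSmoothing
  rcases le_total t t₀ with h | h
  · rw [key t ht t₀ ht₀ h, Ioc_eq_empty (not_lt.2 h)]
    simp
  · rw [key t₀ ht₀ t ht h, Ioc_eq_empty (not_lt.2 h), intervalIntegral.integral_symm]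
    simp

lemma not_integrableOn_Ioc
    (hφ : ¬ IntegrableNearZero τ (fun s => 1 / φ s)) {b : ℝ} (hb : b ∈ Ioo 0 τ) :
    ¬ IntegrableOn (fun s => 1 / φ s) (Ioc 0 b) := fun h =>
  hφ ⟨b, hb, (integrableOn_Icc_iff_integrableOn_Ioc (by simp)).2 h⟩

lemma invSmoothing_zero (H : IsErrorBoundFunction φ τ)
    (hφ : ¬ IntegrableNearZero τ (fun s => 1 / φ s)) (ht₀ : t₀ ∈ Ioo 0 τ) :
    invSmoothing φ t₀ 0 = ⊤ := by
  have h : ∫⁻ s in Ioc 0 t₀, ENNReal.ofReal (1 / φ s) = ⊤ := by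
    by_contra hne
    refine not_integrableOn_Ioc hφ ht₀
      ⟨?_, (hasFiniteIntegral_iff_ofReal ?_).2 (lt_top_iff_ne_top.2 hne)⟩
    · rw [← restrict_Ioo_eq_restrict_Ioc]
      exact (H.continuousOn_one_div.mono
        (Ioo_subset_Ioo_right ht₀.2.le)).aestronglyMeasurable measurableSet_Ioo
    · exact (ae_restrict_mem measurableSet_Ioc).mono fun s hs =>
        one_div_nonneg.2 (H.pos s ⟨hs.1, hs.2.trans_lt ht₀.2⟩).le
  unfold invSmoothing
  rw [h, Ioc_eq_empty (not_lt.2 ht₀.1.le)]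
  simp

lemma strictAntiOn_invSmoothing (H : IsErrorBoundFunction φ τ)
    (hφ : ¬ IntegrableNearZero τ (fun s => 1 / φ s)) (ht₀ : t₀ ∈ Ioo 0 τ) :
    StrictAntiOn (invSmoothing φ t₀) (Ico 0 τ) := by
  intro a ha b hb hab
  have hb' : b ∈ Ioo 0 τ := ⟨ha.1.trans_lt hab, hb.2⟩
  rw [H.invSmoothing_eq_coe ht₀ hb']
  rcases ha.1.eq_or_lt with h | h
  · rw [← h, H.invSmoothing_zero hφ ht₀]
    exact EReal.coe_lt_top _
  · have ha' : a ∈ Ioo 0 τ := ⟨h, ha.2⟩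
    rw [H.invSmoothing_eq_coe ht₀ ha', EReal.coe_lt_coe_iff,
      ← intervalIntegral.integral_add_adjacent_intervals (H.intervalIntegrable ha' hb')
        (H.intervalIntegrable hb' ht₀)]
    have := intervalIntegral.intervalIntegral_pos_of_pos_on (H.intervalIntegrable ha' hb')
      (fun s hs => one_div_pos.2 (H.pos s ⟨h.trans hs.1, hs.2.trans hb.2⟩)) hab
    linarith

/-- Since `1 / φ` is not integrable near `0`, the inverse smoothing function takes every real value
above any value it takes. -/
lemma mem_invSmoothingRange_of_le (H : IsErrorBoundFunction φ τ)
    (hφ : ¬ IntegrableNearZero τ (fun s => 1 / φ s)) (ht₀ : t₀ ∈ Ioo 0 τ) {t : ℝ}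
    (ht : t ∈ Ico 0 τ) {y : EReal} (hy : invSmoothing φ t₀ t ≤ y) :
    y ∈ invSmoothingRange φ τ t₀ := by
  have h0 : invSmoothing φ t₀ 0 ∈ invSmoothingRange φ τ t₀ :=
    mem_image_of_mem _ ⟨le_rfl, ht.1.trans_lt ht.2⟩
  rw [H.invSmoothing_zero hφ ht₀] at h0
  rcases ht.1.eq_or_lt with h | h
  · rw [← h, H.invSmoothing_zero hφ ht₀, top_le_iff] at hy
    rwa [hy]
  have ht' : t ∈ Ioo 0 τ := ⟨h, ht.2⟩
  rw [H.invSmoothing_eq_coe ht₀ ht'] at hy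
  induction y with
  | bot => simp at hy
  | top => exact h0
  | coe y =>
    rw [EReal.coe_le_coe_iff] at hy
    obtain ⟨a, ha0, hat, hya⟩ : ∃ a, 0 < a ∧ a ≤ t ∧ y ≤ ∫ s in a..t₀, 1 / φ s := by
      by_contra! hcon
      let a : ℕ → ℝ := fun n => t / (n + 1)
      have ha0 : ∀ n, 0 < a n := fun n => by positivity
      have hat : ∀ n, a n ≤ t := fun n =>
        div_le_self h.le (by linarith [(Nat.cast_nonneg n : (0:ℝ) ≤ n)])
      have ha : ∀ n, a n ∈ Ioo 0 τ := fun n => ⟨ha0 n, (hat n).trans_lt ht.2⟩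
      have hint : ∀ n, IntegrableOn (fun s => 1 / φ s) (Ioc (a n) t) := fun n =>
        (intervalIntegrable_iff_integrableOn_Ioc_of_le (hat n)).1 (H.intervalIntegrable (ha n) ht')
      refine not_integrableOn_Ioc hφ ht' (integrableOn_Ioc_of_intervalIntegral_norm_bounded_left
        (I := y - ∫ s in t..t₀, 1 / φ s) hint
        (tendsto_const_div_atTop_nhds_zero_nat t |>.comp (tendsto_add_atTop_nat 1) |>.congr
          fun n => by simp [a]) (Eventually.of_forall fun n => ?_))
      have h1 := hcon (a n) (ha0 n) (hat n)
      rw [← intervalIntegral.integral_add_adjacent_intervals (H.intervalIntegrable (ha n) ht')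
        (H.intervalIntegrable ht' ht₀), intervalIntegral.integral_of_le (hat n)] at h1
      have h2 : ∫ s in Ioc (a n) t, ‖1 / φ s‖ = ∫ s in Ioc (a n) t, 1 / φ s :=
        setIntegral_congr_fun measurableSet_Ioc fun s hs => Real.norm_of_nonneg
          (one_div_nonneg.2 (H.pos s ⟨(ha0 n).trans hs.1, hs.2.trans_lt ht.2⟩).le)
      linarith
    have ha' : a ∈ Ioo 0 τ := ⟨ha0, hat.trans_lt ht.2⟩
    -- the intermediate value theorem on `[a, t]`
    have hcont : ContinuousOn (fun u => ∫ s in u..t₀, 1 / φ s) (Icc a t) := by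
      have := intervalIntegral.continuousOn_primitive_interval' (H.intervalIntegrable ha' ht')
        (left_mem_uIcc)
      rw [uIcc_of_le hat] at this
      refine ((continuousOn_const (c := ∫ s in a..t₀, 1 / φ s)).sub this).congr fun u hu => ?_
      have hu' : u ∈ Ioo 0 τ := ⟨ha0.trans_le hu.1, hu.2.trans_lt ht.2⟩
      change _ = (∫ s in a..t₀, 1 / φ s) - ∫ s in a..u, 1 / φ s
      rw [← intervalIntegral.integral_add_adjacent_intervals (H.intervalIntegrable ha' hu')
        (H.intervalIntegrable hu' ht₀)]
      ring
    obtain ⟨u, hu, hyu⟩ := intermediate_value_Icc' hat hcont ⟨hy, hya⟩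
    have hu' : u ∈ Ioo 0 τ := ⟨ha0.trans_le hu.1, hu.2.trans_lt ht.2⟩
    exact ⟨u, ⟨hu'.1.le, hu'.2⟩, by rw [H.invSmoothing_eq_coe ht₀ hu']; simpa using hyu⟩

lemma coe_mem_invSmoothingRange (H : IsErrorBoundFunction φ τ)
    (hφ : ¬ IntegrableNearZero τ (fun s => 1 / φ s)) (ht₀ : t₀ ∈ Ioo 0 τ) {y : ℝ} (hy : 0 ≤ y) :
    (y : EReal) ∈ invSmoothingRange φ τ t₀ := by
  refine H.mem_invSmoothingRange_of_le hφ ht₀ (Ioo_subset_Ico_self ht₀) ?_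
  rw [H.invSmoothing_eq_coe ht₀ ht₀]
  simpa using hy

end IsErrorBoundFunction

lemma invSmoothingInv_mem {φ : ℝ → ℝ} {τ t₀ : ℝ} {y : EReal}
    (hy : y ∈ invSmoothingRange φ τ t₀) : invSmoothingInv φ τ t₀ y ∈ Ico 0 τ :=
  Function.invFunOn_mem hy

lemma invSmoothing_invSmoothingInv {φ : ℝ → ℝ} {τ t₀ : ℝ} {y : EReal}
    (hy : y ∈ invSmoothingRange φ τ t₀) :
    invSmoothing φ t₀ (invSmoothingInv φ τ t₀ y) = y :=
  Function.invFunOn_eq hy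

namespace IsErrorBoundFunction

variable {φ : ℝ → ℝ} {τ t₀ : ℝ}

lemma le_invSmoothingInv_iff (H : IsErrorBoundFunction φ τ)
    (hφ : ¬ IntegrableNearZero τ (fun s => 1 / φ s)) (ht₀ : t₀ ∈ Ioo 0 τ) {t : ℝ}
    (ht : t ∈ Ico 0 τ) {y : EReal} (hy : y ∈ invSmoothingRange φ τ t₀) :
    t ≤ invSmoothingInv φ τ t₀ y ↔ y ≤ invSmoothing φ t₀ t := by
  rw [← (H.strictAntiOn_invSmoothing hφ ht₀).le_iff_ge (invSmoothingInv_mem hy) ht,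
    invSmoothing_invSmoothingInv hy]

lemma invSmoothingInv_coe_mem_Ioo (H : IsErrorBoundFunction φ τ)
    (hφ : ¬ IntegrableNearZero τ (fun s => 1 / φ s)) (ht₀ : t₀ ∈ Ioo 0 τ) {y : ℝ} (hy : 0 ≤ y) :
    invSmoothingInv φ τ t₀ y ∈ Ioo 0 τ := by
  have hy' := H.coe_mem_invSmoothingRange hφ ht₀ hy
  have hm := invSmoothingInv_mem hy'
  refine ⟨lt_of_le_of_ne hm.1 fun h => ?_, hm.2⟩
  have := invSmoothing_invSmoothingInv hy'
  rw [← h, H.invSmoothing_zero hφ ht₀] at this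
  exact EReal.top_ne_coe _ this

lemma invSmoothingInv_anti (H : IsErrorBoundFunction φ τ)
    (hφ : ¬ IntegrableNearZero τ (fun s => 1 / φ s)) (ht₀ : t₀ ∈ Ioo 0 τ) {y z : ℝ} (hy : 0 ≤ y)
    (hyz : y ≤ z) : invSmoothingInv φ τ t₀ z ≤ invSmoothingInv φ τ t₀ y := by
  have hz' := H.coe_mem_invSmoothingRange hφ ht₀ (hy.trans hyz)
  rw [H.le_invSmoothingInv_iff hφ ht₀ (invSmoothingInv_mem hz')
    (H.coe_mem_invSmoothingRange hφ ht₀ hy), invSmoothing_invSmoothingInv hz']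
  exact_mod_cast hyz

/-- The increment of `Ψ⁻¹` read as an integral of `1 / φ`. -/
lemma integral_invSmoothingInv (H : IsErrorBoundFunction φ τ)
    (hφ : ¬ IntegrableNearZero τ (fun s => 1 / φ s)) (ht₀ : t₀ ∈ Ioo 0 τ) {y z : ℝ} (hy : 0 ≤ y)
    (hz : 0 ≤ z) :
    ∫ s in invSmoothingInv φ τ t₀ z..invSmoothingInv φ τ t₀ y, 1 / φ s = z - y := by
  have key : ∀ w : ℝ, 0 ≤ w → ∫ s in invSmoothingInv φ τ t₀ w..t₀, 1 / φ s = w := by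
    intro w hw
    have h := invSmoothing_invSmoothingInv (H.coe_mem_invSmoothingRange hφ ht₀ hw)
    rw [H.invSmoothing_eq_coe ht₀ (H.invSmoothingInv_coe_mem_Ioo hφ ht₀ hw)] at h
    exact_mod_cast h
  have hy' := H.invSmoothingInv_coe_mem_Ioo hφ ht₀ hy
  have hz' := H.invSmoothingInv_coe_mem_Ioo hφ ht₀ hz
  have h := intervalIntegral.integral_add_adjacent_intervals (H.intervalIntegrable hz' hy')
    (H.intervalIntegrable hy' ht₀)
  rw [key y hy, key z hz] at h
  linarith

/-- A decrease at least as large as that of an explicit Euler step of length `c` for the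
differential equation `u' = -φ u` increases `Ψ` by at least `c`. -/
lemma invSmoothing_add_le (H : IsErrorBoundFunction φ τ)
    (hφ : ¬ IntegrableNearZero τ (fun s => 1 / φ s)) (ht₀ : t₀ ∈ Ioo 0 τ) {t t' c : ℝ}
    (ht : t < τ) (ht' : 0 ≤ t') (htt' : t' ≤ t) (hstep : t' ≤ t - c * φ t) :
    invSmoothing φ t₀ t + (c : EReal) ≤ invSmoothing φ t₀ t' := by
  rcases ht'.eq_or_lt with h | h
  · rw [← h, H.invSmoothing_zero hφ ht₀]
    exact le_top
  have h1 : t ∈ Ioo 0 τ := ⟨h.trans_le htt', ht⟩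
  have h2 : t' ∈ Ioo 0 τ := ⟨h, htt'.trans_lt ht⟩
  rw [H.invSmoothing_eq_coe ht₀ h1, H.invSmoothing_eq_coe ht₀ h2, ← EReal.coe_add,
    EReal.coe_le_coe_iff, ← intervalIntegral.integral_add_adjacent_intervals
      (H.intervalIntegrable h2 h1) (H.intervalIntegrable h1 ht₀)]
  have h3 := H.integral_le_smoothing_increment h htt' ht
  have h4 : c ≤ (t - t') / φ t := by
    rw [le_div_iff₀ (H.pos t h1)]
    linarith
  linarith

lemma tendsto_invSmoothingInv (H : IsErrorBoundFunction φ τ)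
    (hφ : ¬ IntegrableNearZero τ (fun s => 1 / φ s)) (ht₀ : t₀ ∈ Ioo 0 τ) :
    Tendsto (fun y : ℝ => invSmoothingInv φ τ t₀ (y : EReal)) atTop (𝓝 0) := by
  rw [Metric.tendsto_nhds]
  intro ε hε
  have ha : min (ε / 2) t₀ ∈ Ioo 0 τ :=
    ⟨lt_min (half_pos hε) ht₀.1, (min_le_right _ _).trans_lt ht₀.2⟩
  filter_upwards [eventually_ge_atTop 0,
    eventually_ge_atTop (∫ s in min (ε / 2) t₀..t₀, 1 / φ s)] with y hy0 hy
  have hr := H.coe_mem_invSmoothingRange hφ ht₀ hy0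
  have hm := invSmoothingInv_mem hr
  have h1 : invSmoothingInv φ τ t₀ y ≤ min (ε / 2) t₀ := by
    rw [← (H.strictAntiOn_invSmoothing hφ ht₀).le_iff_ge (Ioo_subset_Ico_self ha) hm,
      invSmoothing_invSmoothingInv hr, H.invSmoothing_eq_coe ht₀ ha]
    exact_mod_cast hy
  rw [Real.dist_eq, sub_zero, abs_of_nonneg hm.1]
  exact h1.trans_lt ((min_le_left _ _).trans_lt (half_lt_self hε))

lemma exists_coe_le_invSmoothing (H : IsErrorBoundFunction φ τ)
    (hφ : ¬ IntegrableNearZero τ (fun s => 1 / φ s)) (ht₀ : t₀ ∈ Ioo 0 τ) {t : ℝ}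
    (ht : t ∈ Ico 0 τ) : ∃ b : ℝ, (b : EReal) ≤ invSmoothing φ t₀ t := by
  rcases ht.1.eq_or_lt with h | h
  · exact ⟨0, by rw [← h, H.invSmoothing_zero hφ ht₀]; exact le_top⟩
  · exact ⟨_, (H.invSmoothing_eq_coe ht₀ ⟨h, ht.2⟩).ge⟩

/-! ### The desingularization function -/

lemma intervalIntegrable_zero (H : IsErrorBoundFunction φ τ)
    (hΦ : IntegrableNearZero τ (fun s => 1 / √(φ s))) {b : ℝ} (hb : b ∈ Ico 0 τ) :
    IntervalIntegrable (fun s => 1 / √(φ s)) volume 0 b := by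
  obtain ⟨a, ha, hint⟩ := hΦ
  rcases le_total b a with h | h
  · rw [intervalIntegrable_iff_integrableOn_Icc_of_le hb.1]
    exact hint.mono_set (Icc_subset_Icc_right h)
  · refine ((intervalIntegrable_iff_integrableOn_Icc_of_le ha.1.le).2 hint).trans ?_
    exact (H.continuousOn_one_div_sqrt.mono
      (uIcc_subset_Ioo ha ⟨ha.1.trans_le h, hb.2⟩)).intervalIntegrable

lemma intervalIntegrable_sqrt (H : IsErrorBoundFunction φ τ)
    (hΦ : IntegrableNearZero τ (fun s => 1 / √(φ s))) {a b : ℝ} (ha : a ∈ Ico 0 τ)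
    (hb : b ∈ Ico 0 τ) : IntervalIntegrable (fun s => 1 / √(φ s)) volume a b :=
  (H.intervalIntegrable_zero hΦ ha).symm.trans (H.intervalIntegrable_zero hΦ hb)

lemma desingularization_sub (H : IsErrorBoundFunction φ τ)
    (hΦ : IntegrableNearZero τ (fun s => 1 / √(φ s))) {a b : ℝ} (ha : a ∈ Ico 0 τ)
    (hb : b ∈ Ico 0 τ) :
    desingularization φ b - desingularization φ a = ∫ s in a..b, 1 / √(φ s) :=
  intervalIntegral.integral_interval_sub_left (H.intervalIntegrable_zero hΦ hb)
    (H.intervalIntegrable_zero hΦ ha)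

lemma continuousOn_desingularization (H : IsErrorBoundFunction φ τ)
    (hΦ : IntegrableNearZero τ (fun s => 1 / √(φ s))) {b : ℝ} (hb : b ∈ Ico 0 τ) :
    ContinuousOn (desingularization φ) (Icc 0 b) := by
  have := intervalIntegral.continuousOn_primitive_interval' (H.intervalIntegrable_zero hΦ hb)
    (left_mem_uIcc)
  rwa [uIcc_of_le hb.1] at this

lemma monotoneOn_desingularization (H : IsErrorBoundFunction φ τ)
    (hΦ : IntegrableNearZero τ (fun s => 1 / √(φ s))) :
    MonotoneOn (desingularization φ) (Ico 0 τ) := by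
  intro a ha b hb hab
  have h1 := H.desingularization_sub hΦ ha hb
  have h2 : 0 ≤ ∫ s in a..b, 1 / √(φ s) :=
    intervalIntegral.integral_nonneg hab fun s _ => by positivity
  linarith

@[simp] lemma _root_.desingularization_zero (φ : ℝ → ℝ) : desingularization φ 0 = 0 := by
  simp [desingularization]

lemma sub_div_sqrt_le (H : IsErrorBoundFunction φ τ)
    (hΦ : IntegrableNearZero τ (fun s => 1 / √(φ s))) {a b : ℝ} (ha : 0 ≤ a) (hab : a ≤ b)
    (hb : b < τ) :
    (b - a) / √(φ b) ≤ desingularization φ b - desingularization φ a := by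
  rw [H.desingularization_sub hΦ ⟨ha, hab.trans_lt hb⟩ ⟨ha.trans hab, hb⟩]
  have h := intervalIntegral.integral_mono_on_of_le_Ioo (f := fun _ => 1 / √(φ b))
    (g := fun s => 1 / √(φ s)) hab intervalIntegrable_const
    (H.intervalIntegrable_sqrt hΦ ⟨ha, hab.trans_lt hb⟩ ⟨ha.trans hab, hb⟩)
    fun s hs => one_div_le_one_div_of_le
      (Real.sqrt_pos.2 (H.pos s ⟨ha.trans_lt hs.1, hs.2.trans hb⟩))
      (Real.sqrt_le_sqrt (H.monotoneOn ⟨(ha.trans_lt hs.1).le, hs.2.trans hb⟩ ⟨ha.trans hab, hb⟩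
        hs.2.le))
  simpa [div_eq_mul_inv] using h

/-- Concavity of the desingularization function, in the form of a tangent line at `m > 0`. -/
lemma desingularization_le_tangent (H : IsErrorBoundFunction φ τ)
    (hΦ : IntegrableNearZero τ (fun s => 1 / √(φ s))) {m t : ℝ} (hm : m ∈ Ioo 0 τ)
    (ht : t ∈ Ico 0 τ) :
    desingularization φ t ≤ desingularization φ m + (t - m) / √(φ m) := by
  rcases le_total t m with h | h
  · have e : (m - t) / √(φ m) = -((t - m) / √(φ m)) := by ring
    linarith [H.sub_div_sqrt_le hΦ ht.1 h hm.2]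
  · have h1 := H.desingularization_sub hΦ (Ioo_subset_Ico_self hm) ht
    have h2 := intervalIntegral.integral_mono_on (f := fun s => 1 / √(φ s))
      (g := fun _ => 1 / √(φ m)) h
      (H.intervalIntegrable_sqrt hΦ (Ioo_subset_Ico_self hm) ht) intervalIntegrable_const
      fun s hs => one_div_le_one_div_of_le (Real.sqrt_pos.2 (H.pos m hm))
        (Real.sqrt_le_sqrt (H.monotoneOn (Ioo_subset_Ico_self hm)
          ⟨hm.1.le.trans hs.1, hs.2.trans_lt ht.2⟩ hs.1))
    have h3 : ∫ s in m..t, 1 / √(φ m) = (t - m) / √(φ m) := by simp [div_eq_mul_inv]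
    linarith

lemma sqrt_mul_integral_le (H : IsErrorBoundFunction φ τ)
    (hΦ : IntegrableNearZero τ (fun s => 1 / √(φ s))) {a b : ℝ} (ha : 0 < a) (hab : a ≤ b)
    (hb : b < τ) :
    √(φ a) * ∫ s in a..b, 1 / φ s ≤ desingularization φ b - desingularization φ a := by
  have ha' : a ∈ Ioo 0 τ := ⟨ha, hab.trans_lt hb⟩
  have hb' : b ∈ Ioo 0 τ := ⟨ha.trans_le hab, hb⟩
  rw [H.desingularization_sub hΦ (Ioo_subset_Ico_self ha') (Ioo_subset_Ico_self hb'),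
    ← intervalIntegral.integral_const_mul]
  refine intervalIntegral.integral_mono_on hab ((H.intervalIntegrable ha' hb').const_mul _)
    (H.intervalIntegrable_sqrt hΦ (Ioo_subset_Ico_self ha') (Ioo_subset_Ico_self hb'))
    fun s hs => ?_
  have hs' : s ∈ Ioo 0 τ := ⟨ha.trans_le hs.1, hs.2.trans_lt hb⟩
  have h1 := Real.sqrt_pos.2 (H.pos s hs')
  have h2 := Real.sqrt_le_sqrt
    (H.monotoneOn (Ioo_subset_Ico_self ha') (Ioo_subset_Ico_self hs') hs.1)
  calc √(φ a) * (1 / φ s) ≤ √(φ s) * (1 / φ s) := by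
        gcongr
        exact one_div_nonneg.2 (H.pos s hs').le
    _ = 1 / √(φ s) := by
        nth_rw 2 [← Real.mul_self_sqrt (H.pos s hs').le]
        field_simp

end IsErrorBoundFunction

/-! ### Sums of indicators with conditional probabilities bounded below -/

/-- Hoeffding's lemma for a Bernoulli variable, as an inequality between real numbers. -/
lemma one_sub_add_mul_exp_neg_le {p : ℝ} (hp0 : 0 ≤ p) (hp1 : p ≤ 1) (a : ℝ) :
    1 - p + p * Real.exp (-a) ≤ Real.exp (-(p * a) + a ^ 2 / 8) := by
  let ν : Measure ℝ := ENNReal.ofReal p • Measure.dirac 1 + ENNReal.ofReal (1 - p) • Measure.dirac 0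
  have hν : IsProbabilityMeasure ν := ⟨by
    simp [ν, ← ENNReal.ofReal_add hp0 (sub_nonneg.2 hp1)]⟩
  have hint : ∀ f : ℝ → ℝ, ∫ y, f y ∂ν = p * f 1 + (1 - p) * f 0 := by
    intro f
    rw [integral_add_measure, integral_smul_measure, integral_smul_measure, integral_dirac,
      integral_dirac, ENNReal.toReal_ofReal hp0, ENNReal.toReal_ofReal (sub_nonneg.2 hp1)]
    · simp
    · exact (integrable_dirac (by simp)).smul_measure ENNReal.ofReal_ne_top
    · exact (integrable_dirac (by simp)).smul_measure ENNReal.ofReal_ne_top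
  have hmem : ∀ᵐ y ∂ν, (id y : ℝ) ∈ Icc (0 : ℝ) 1 := by
    refine ae_add_measure_iff.2 ⟨?_, ?_⟩ <;> refine Measure.ae_smul_measure ?_ _ <;>
      rw [ae_dirac_eq] <;> simp
  have h := (hasSubgaussianMGF_of_mem_Icc (μ := ν) (X := id) aemeasurable_id hmem).mgf_le (-a)
  rw [mgf, hint, hint] at h
  have e1 : Real.exp (-a * (id 1 - (p * id 1 + (1 - p) * id 0))) =
      Real.exp (p * a) * Real.exp (-a) := by
    rw [← Real.exp_add]; congr 1; simp only [id]; ring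
  have e2 : Real.exp (-a * (id 0 - (p * id 1 + (1 - p) * id 0))) = Real.exp (p * a) := by
    congr 1; simp only [id]; ring
  have e3 : Real.exp (((‖(1 : ℝ) - 0‖₊ / 2) ^ 2 : NNReal) * (-a) ^ 2 / 2) =
      Real.exp (a ^ 2 / 8) := by
    congr 1; simp; ring
  rw [e1, e2, e3] at h
  rw [Real.exp_add, Real.exp_neg (p * a)]
  have := Real.exp_pos (p * a)
  rw [inv_mul_eq_div, le_div_iff₀ this]
  linarith

section Bernoulli

variable {Ω : Type*} {m : MeasurableSpace Ω} {μ : Measure Ω} [IsProbabilityMeasure μ]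
  {ℱ : Filtration ℕ m} {ξ : ℕ → Ω → ℝ} {p : ℝ} {α : ℕ → ℝ}

lemma mul_integral_le_integral_mul {m' : MeasurableSpace Ω} (hm : m' ≤ m) {Z ζ : Ω → ℝ} {C : ℝ}
    (hZ : StronglyMeasurable[m'] Z) (hZ0 : ∀ ω, 0 ≤ Z ω) (hZC : ∀ ω, Z ω ≤ C)
    (hζ : Integrable ζ μ) (hp : ∀ᵐ ω ∂μ, p ≤ (μ[ζ|m']) ω) :
    p * ∫ ω, Z ω ∂μ ≤ ∫ ω, Z ω * ζ ω ∂μ := by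
  have hZm := (hZ.mono hm).aestronglyMeasurable (μ := μ)
  have hbd : ∀ᵐ ω ∂μ, ‖Z ω‖ ≤ C :=
    Eventually.of_forall fun ω => by rw [Real.norm_of_nonneg (hZ0 ω)]; exact hZC ω
  have hZi : Integrable Z μ := Integrable.of_bound hZm C hbd
  have h1 : Integrable (Z * ζ) μ := hζ.bdd_mul hZm hbd
  have h2 : Integrable (Z * μ[ζ|m']) μ := integrable_condExp.bdd_mul hZm hbd
  have h3 := condExp_mul_of_stronglyMeasurable_left hZ h1 hζ
  calc p * ∫ ω, Z ω ∂μ = ∫ ω, p * Z ω ∂μ := (integral_const_mul _ _).symm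
    _ ≤ ∫ ω, (Z * μ[ζ|m']) ω ∂μ := by
        refine integral_mono_ae (hZi.const_mul p) h2 (hp.mono fun ω h => ?_)
        simp only [Pi.mul_apply]
        rw [mul_comm]
        exact mul_le_mul_of_nonneg_left h (hZ0 ω)
    _ = ∫ ω, (μ[Z * ζ|m']) ω ∂μ := integral_congr_ae h3.symm
    _ = ∫ ω, Z ω * ζ ω ∂μ := integral_condExp hm

lemma measurable_weighted_sum (hξ : ∀ k, Measurable[ℱ (k + 1)] (ξ k)) (k : ℕ) :
    Measurable[ℱ k] fun ω => ∑ i ∈ Finset.range k, α i * ξ i ω :=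
  Finset.measurable_fun_sum _ fun i hi =>
    (((hξ i).mono (ℱ.mono (Finset.mem_range.1 hi)) le_rfl).const_mul _)

/-- The exponential moment bound behind the Azuma–Hoeffding inequality. -/
lemma integral_exp_neg_weighted_sum_le (hξ : ∀ k, Measurable[ℱ (k + 1)] (ξ k))
    (h01 : ∀ k ω, ξ k ω = 0 ∨ ξ k ω = 1) (hp : ∀ k, ∀ᵐ ω ∂μ, p ≤ (μ[ξ k|ℱ k]) ω)
    (hp0 : 0 ≤ p) (hp1 : p ≤ 1) (hα : ∀ k, 0 ≤ α k) {l : ℝ} (hl : 0 ≤ l) (k : ℕ) :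
    ∫ ω, Real.exp (-l * ∑ i ∈ Finset.range k, α i * ξ i ω) ∂μ ≤
      Real.exp (-(l * p) * ∑ i ∈ Finset.range k, α i +
        l ^ 2 / 8 * ∑ i ∈ Finset.range k, α i ^ 2) := by
  induction k with
  | zero => simp
  | succ k ih =>
    set Z : Ω → ℝ := fun ω => Real.exp (-l * ∑ i ∈ Finset.range k, α i * ξ i ω) with hZdef
    have hξ0 : ∀ k ω, 0 ≤ ξ k ω := fun k ω => by rcases h01 k ω with h | h <;> simp [h]
    have hZ : StronglyMeasurable[ℱ k] Z :=
      (((measurable_weighted_sum hξ k).const_mul (-l)).exp).stronglyMeasurable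
    have hZ0 : ∀ ω, 0 ≤ Z ω := fun ω => (Real.exp_pos _).le
    have hZ1 : ∀ ω, Z ω ≤ 1 := fun ω => by
      rw [hZdef, Real.exp_le_one_iff]
      have := Finset.sum_nonneg fun i (_ : i ∈ Finset.range k) => mul_nonneg (hα i) (hξ0 i ω)
      nlinarith
    have hbd : ∀ᵐ ω ∂μ, ‖Z ω‖ ≤ 1 :=
      Eventually.of_forall fun ω => by rw [Real.norm_of_nonneg (hZ0 ω)]; exact hZ1 ω
    have hZm := (hZ.mono (ℱ.le k)).aestronglyMeasurable (μ := μ)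
    have hξi : Integrable (ξ k) μ :=
      Integrable.of_bound ((hξ k).mono (ℱ.le _) le_rfl).aestronglyMeasurable 1
        (Eventually.of_forall fun ω => by rcases h01 k ω with h | h <;> simp [h])
    have key := mul_integral_le_integral_mul (ℱ.le k) hZ hZ0 hZ1 hξi (hp k)
    have hZi : Integrable Z μ := Integrable.of_bound hZm 1 hbd
    have hc : 0 ≤ 1 - Real.exp (-(l * α k)) := by
      rw [sub_nonneg, Real.exp_le_one_iff]
      nlinarith [mul_nonneg hl (hα k)]
    have hI : 0 ≤ ∫ ω, Z ω ∂μ := integral_nonneg hZ0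
    calc ∫ ω, Real.exp (-l * ∑ i ∈ Finset.range (k + 1), α i * ξ i ω) ∂μ
        = ∫ ω, Z ω - (1 - Real.exp (-(l * α k))) * (Z ω * ξ k ω) ∂μ := by
          refine integral_congr_ae (Eventually.of_forall fun ω => ?_)
          -- `ξ` takes the values `0` and `1`, so `exp (-aξ) = 1 - (1 - exp (-a)) ξ`
          simp only [Finset.sum_range_succ, mul_add, Real.exp_add]
          rcases h01 k ω with h | h
          · simp [h, hZdef]
          · simp only [h, hZdef, mul_one, neg_mul]; ring
      _ = ∫ ω, Z ω ∂μ - (1 - Real.exp (-(l * α k))) * ∫ ω, Z ω * ξ k ω ∂μ := by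
          rw [integral_sub hZi ((hξi.bdd_mul hZm hbd).const_mul _), integral_const_mul]
      _ ≤ ∫ ω, Z ω ∂μ - (1 - Real.exp (-(l * α k))) * (p * ∫ ω, Z ω ∂μ) := by gcongr
      _ = (1 - p + p * Real.exp (-(l * α k))) * ∫ ω, Z ω ∂μ := by ring
      _ ≤ Real.exp (-(p * (l * α k)) + (l * α k) ^ 2 / 8) *
          Real.exp (-(l * p) * ∑ i ∈ Finset.range k, α i +
            l ^ 2 / 8 * ∑ i ∈ Finset.range k, α i ^ 2) :=
          mul_le_mul (one_sub_add_mul_exp_neg_le hp0 hp1 _) ih hI (Real.exp_pos _).le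
      _ = _ := by
          rw [← Real.exp_add, Finset.sum_range_succ, Finset.sum_range_succ]
          congr 1
          ring

/-- A lower tail bound of Azuma–Hoeffding type. -/
lemma measureReal_weighted_sum_le (hξ : ∀ k, Measurable[ℱ (k + 1)] (ξ k))
    (h01 : ∀ k ω, ξ k ω = 0 ∨ ξ k ω = 1) (hp : ∀ k, ∀ᵐ ω ∂μ, p ≤ (μ[ξ k|ℱ k]) ω)
    (hp0 : 0 ≤ p) (hp1 : p ≤ 1) (hα : ∀ k, 0 ≤ α k) {A : ℝ} (hA : 0 < A) (hαA : ∀ k, α k ≤ A)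
    {ε : ℝ} (hε : 0 ≤ ε) (k : ℕ) :
    μ.real {ω | ∑ i ∈ Finset.range k, α i * ξ i ω ≤ (p - ε) * ∑ i ∈ Finset.range k, α i} ≤
      Real.exp (-(2 * ε ^ 2 / A) * ∑ i ∈ Finset.range k, α i) := by
  set s := ∑ i ∈ Finset.range k, α i with hs
  -- the exponent minimizing the Chernoff bound
  set l := 4 * ε / A with hl
  have hl0 : 0 ≤ l := by positivity
  have hξ0 : ∀ k ω, 0 ≤ ξ k ω := fun k ω => by rcases h01 k ω with h | h <;> simp [h]
  have hsq : ∑ i ∈ Finset.range k, α i ^ 2 ≤ A * s := by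
    rw [hs, Finset.mul_sum]
    exact Finset.sum_le_sum fun i _ => by rw [sq]; exact mul_le_mul_of_nonneg_right (hαA i) (hα i)
  have hmeas : Measurable fun ω => ∑ i ∈ Finset.range k, α i * ξ i ω :=
    (measurable_weighted_sum hξ k).mono (ℱ.le k) le_rfl
  have hint : Integrable (fun ω => Real.exp (-l * ∑ i ∈ Finset.range k, α i * ξ i ω)) μ := by
    refine Integrable.of_bound (hmeas.const_mul _).exp.aestronglyMeasurable 1
      (Eventually.of_forall fun ω => ?_)
    rw [Real.norm_of_nonneg (Real.exp_pos _).le, Real.exp_le_one_iff]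
    have := Finset.sum_nonneg fun i (_ : i ∈ Finset.range k) => mul_nonneg (hα i) (hξ0 i ω)
    nlinarith
  refine (measure_le_le_exp_mul_mgf _ (neg_nonpos.2 hl0) hint).trans ?_
  refine (mul_le_mul_of_nonneg_left (integral_exp_neg_weighted_sum_le hξ h01 hp hp0 hp1 hα hl0 k)
    (Real.exp_pos _).le).trans ?_
  rw [← Real.exp_add, Real.exp_le_exp]
  have h1 : l ^ 2 / 8 * ∑ i ∈ Finset.range k, α i ^ 2 ≤ l ^ 2 / 8 * (A * s) := by gcongr
  have h2 : -(-l) * ((p - ε) * s) + (-(l * p) * s + l ^ 2 / 8 * (A * s)) =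
      -(2 * ε ^ 2 / A) * s := by
    rw [hl]; field_simp; ring
  linarith

/-- Almost surely, the weighted sum of the indicators is eventually at least any fraction `q < p` of
the sum of the weights. The tail bound is summable along the first indices at which the sum of the
weights exceeds the integers, and monotonicity fills the gaps. -/
lemma ae_eventually_mul_le_weighted_sum (hξ : ∀ k, Measurable[ℱ (k + 1)] (ξ k))
    (h01 : ∀ k ω, ξ k ω = 0 ∨ ξ k ω = 1) (hp : ∀ k, ∀ᵐ ω ∂μ, p ≤ (μ[ξ k|ℱ k]) ω)
    (hp1 : p ≤ 1) (hα : ∀ k, 0 ≤ α k) {A : ℝ} (hA : 0 < A) (hαA : ∀ k, α k ≤ A)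
    (hsum : Tendsto (fun k => ∑ i ∈ Finset.range k, α i) atTop atTop) {q : ℝ} (hq0 : 0 ≤ q)
    (hq : q < p) :
    ∀ᵐ ω ∂μ, ∀ᶠ k in atTop,
      q * ∑ i ∈ Finset.range k, α i ≤ ∑ i ∈ Finset.range k, α i * ξ i ω := by
  set s : ℕ → ℝ := fun k => ∑ i ∈ Finset.range k, α i with hs
  have hξ0 : ∀ k ω, 0 ≤ ξ k ω := fun k ω => by rcases h01 k ω with h | h <;> simp [h]
  have hp0 : 0 ≤ p := hq0.trans hq.le
  have hex : ∀ n : ℕ, ∃ k, (n : ℝ) ≤ s k := fun n => (hsum.eventually_ge_atTop (n : ℝ)).exists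
  classical
  let κ : ℕ → ℕ := fun n => Nat.find (hex n)
  have hκ : ∀ n : ℕ, (n : ℝ) ≤ s (κ n) := fun n => Nat.find_spec (hex n)
  set ε := (p - q) / 2 with hε
  have hε0 : 0 < ε := by rw [hε]; linarith
  set B : ℕ → Set Ω := fun n =>
    {ω | ∑ i ∈ Finset.range (κ n), α i * ξ i ω ≤ (p - ε) * s (κ n)} with hB
  have hc : 0 < 2 * ε ^ 2 / A := by positivity
  have hBle : ∀ n, μ (B n) ≤ ENNReal.ofReal (Real.exp (-(2 * ε ^ 2 / A)) ^ n) := by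
    intro n
    rw [← ofReal_measureReal]
    refine ENNReal.ofReal_le_ofReal ((measureReal_weighted_sum_le hξ h01 hp hp0 hp1 hα hA hαA
      hε0.le (κ n)).trans ?_)
    rw [← Real.exp_nat_mul, Real.exp_le_exp]
    rw [mul_comm]
    exact mul_le_mul_of_nonpos_right (hκ n) (by linarith)
  have hfin : ∑' n, μ (B n) ≠ ⊤ := by
    refine ne_top_of_le_ne_top ?_ (ENNReal.tsum_le_tsum hBle)
    have hsm : Summable fun n : ℕ => Real.exp (-(2 * ε ^ 2 / A)) ^ n :=
      summable_geometric_of_lt_one (Real.exp_pos _).le (Real.exp_lt_one_iff.2 (by linarith))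
    exact hsm.tsum_ofReal_ne_top
  filter_upwards [ae_eventually_notMem hfin] with ω hω
  have hfl : Tendsto (fun k => ⌊s k⌋₊) atTop atTop := tendsto_nat_floor_atTop.comp hsum
  filter_upwards [hfl.eventually hω, hsum.eventually_ge_atTop (p / ε)] with k hk hk2
  have hsk : 0 ≤ s k := Finset.sum_nonneg fun i _ => hα i
  have h1 : κ ⌊s k⌋₊ ≤ k := Nat.find_min' _ (Nat.floor_le hsk)
  have h2 : ∑ i ∈ Finset.range (κ ⌊s k⌋₊), α i * ξ i ω ≤ ∑ i ∈ Finset.range k, α i * ξ i ω :=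
    Finset.sum_le_sum_of_subset_of_nonneg (Finset.range_mono h1)
      fun i _ _ => mul_nonneg (hα i) (hξ0 i ω)
  have h3 : (p - ε) * s (κ ⌊s k⌋₊) < ∑ i ∈ Finset.range (κ ⌊s k⌋₊), α i * ξ i ω := not_le.1 hk
  have h4 : s k < ⌊s k⌋₊ + 1 := Nat.lt_floor_add_one _
  have h5 := hκ ⌊s k⌋₊
  have h6 : 0 ≤ p - ε := by rw [hε]; linarith
  have h7 : p ≤ ε * s k := by
    rw [div_le_iff₀ hε0] at hk2
    linarith
  have h8 : (p - ε) * (s k - 1) ≤ (p - ε) * s (κ ⌊s k⌋₊) := by gcongr; linarith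
  have h9 : q = p - 2 * ε := by rw [hε]; ring
  rw [h9]
  change (p - 2 * ε) * s k ≤ _
  nlinarith

end Bernoulli

/-! ### Path length under a rate of decrease -/

namespace IsErrorBoundFunction

variable {φ : ℝ → ℝ} {τ t₀ : ℝ}

/-- A sequence of step lengths `δ` with sufficient decrease `c₁ δ ^ 2 / α ≤ t k - t (k + 1)` has a
tail controlled by the desingularization function at `v k = Ψ⁻¹(c ∑_{i < k} α i)`, as soon as `t` is
below the shifted sequence `v (k + 1)`. No lower bound on the steps is needed: the inequality of
arithmetic and geometric means with weight `w k = √(φ (v (k + 1)))` splits `δ k` into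
`α k * w k`, which is summed by the differential equation for `v`, and
`(t k - t (k + 1)) / w k`, which is summed by parts. -/
lemma sum_Ico_le_desingularization (H : IsErrorBoundFunction φ τ)
    (hφ : ¬ IntegrableNearZero τ (fun s => 1 / φ s)) (ht₀ : t₀ ∈ Ioo 0 τ)
    (hΦ : IntegrableNearZero τ (fun s => 1 / √(φ s)))
    {α : ℕ → ℝ} (hα : ∀ k, 0 < α k) {c c₁ r : ℝ} (hc : 0 < c) (hc₁ : 0 < c₁) (hr : 0 < r)
    (hrc : r ^ 2 = c₁ * c) {t δ : ℕ → ℝ} (ht0 : ∀ k, 0 ≤ t k)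
    (hdec : ∀ k, δ k ^ 2 ≤ α k / c₁ * (t k - t (k + 1)))
    {k : ℕ} (hk : ∀ j, k ≤ j →
      t j ≤ invSmoothingInv φ τ t₀ ((c * ∑ i ∈ Finset.range (j + 1), α i : ℝ) : EReal))
    {n : ℕ} (hkn : k ≤ n) :
    ∑ j ∈ Finset.Ico k n, δ j ≤
      1 / r * desingularization φ
        (invSmoothingInv φ τ t₀ ((c * ∑ i ∈ Finset.range k, α i : ℝ) : EReal)) := by
  set y : ℕ → ℝ := fun j => c * ∑ i ∈ Finset.range j, α i with hy
  set v : ℕ → ℝ := fun j => invSmoothingInv φ τ t₀ (y j : EReal) with hv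
  change ∑ j ∈ Finset.Ico k n, δ j ≤ 1 / r * desingularization φ (v k)
  replace hk : ∀ j, k ≤ j → t j ≤ v (j + 1) := hk
  have hy0 : ∀ j, 0 ≤ y j := fun j =>
    mul_nonneg hc.le (Finset.sum_nonneg fun i _ => (hα i).le)
  have hysucc : ∀ j, y (j + 1) - y j = c * α j := fun j => by
    simp only [hy, Finset.sum_range_succ]; ring
  have hvm : ∀ j, v j ∈ Ioo 0 τ := fun j => H.invSmoothingInv_coe_mem_Ioo hφ ht₀ (hy0 j)
  have hvm' : ∀ j, v j ∈ Ico 0 τ := fun j => Ioo_subset_Ico_self (hvm j)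
  have hvanti : ∀ j, v (j + 1) ≤ v j := fun j =>
    H.invSmoothingInv_anti hφ ht₀ (hy0 j) (by nlinarith [hysucc j, hα j])
  set w : ℕ → ℝ := fun j => √(φ (v (j + 1))) with hw
  have hw0 : ∀ j, 0 < w j := fun j => Real.sqrt_pos.2 (H.pos _ (hvm _))
  have hwanti : ∀ j, w (j + 1) ≤ w j := fun j =>
    Real.sqrt_le_sqrt (H.monotoneOn (hvm' _) (hvm' _) (hvanti _))
  have hΦ0 : ∀ j, 0 ≤ desingularization φ (v j) := fun j => by
    have := H.monotoneOn_desingularization hΦ ⟨le_rfl, ht₀.1.trans ht₀.2⟩ (hvm' j) (hvm j).1.le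
    simpa using this
  have hA : c * ∑ j ∈ Finset.Ico k n, α j * w j ≤
      desingularization φ (v k) - desingularization φ (v n) := by
    induction n, hkn using Nat.le_induction with
    | base => simp
    | succ n hn ih =>
      rw [Finset.sum_Ico_succ_top hn]
      have h1 := H.sqrt_mul_integral_le hΦ (hvm (n + 1)).1 (hvanti n) (hvm n).2
      rw [H.integral_invSmoothingInv hφ ht₀ (hy0 n) (hy0 (n + 1)), hysucc] at h1
      have h2 : √(φ (v (n + 1))) * (c * α n) = c * (α n * w n) := by rw [hw]; ring
      linarith
  have hB : ∑ j ∈ Finset.Ico k n, (t j - t (j + 1)) / w j ≤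
      desingularization φ (v (k + 1)) - desingularization φ (v (n + 1)) +
        (v (n + 1) - t n) / w n := by
    clear hA
    induction n, hkn using Nat.le_induction with
    | base => simpa using div_nonneg (sub_nonneg.2 (hk k le_rfl)) (hw0 k).le
    | succ n hn ih =>
      rw [Finset.sum_Ico_succ_top hn]
      have h1 : (v (n + 1) - v (n + 2)) / w n ≤
          desingularization φ (v (n + 1)) - desingularization φ (v (n + 2)) :=
        H.sub_div_sqrt_le hΦ (hvm (n + 2)).1.le (hvanti (n + 1)) (hvm (n + 1)).2
      have h2 : (v (n + 2) - t (n + 1)) / w n ≤ (v (n + 2) - t (n + 1)) / w (n + 1) :=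
        div_le_div_of_nonneg_left (sub_nonneg.2 (hk (n + 1) (by omega))) (hw0 _) (hwanti n)
      have h3 : (v (n + 1) - t n) / w n + (t n - t (n + 1)) / w n =
          (v (n + 1) - v (n + 2)) / w n + (v (n + 2) - t (n + 1)) / w n := by ring
      linarith
  have hB' : ∑ j ∈ Finset.Ico k n, (t j - t (j + 1)) / w j ≤ desingularization φ (v k) := by
    have h1 := H.sub_div_sqrt_le hΦ le_rfl (hvm (n + 1)).1.le (hvm (n + 1)).2
    have h2 : (v (n + 1) - t n) / w n ≤ (v (n + 1) - 0) / w n :=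
      div_le_div_of_nonneg_right (by linarith [ht0 n]) (hw0 n).le
    have h3 := H.monotoneOn_desingularization hΦ (hvm' (k + 1)) (hvm' k) (hvanti k)
    simp only [desingularization_zero] at h1
    change (v (n + 1) - 0) / w n ≤ _ at h1
    linarith
  have hδ : ∀ j, δ j ≤ 1 / (2 * r) * (c * (α j * w j) + (t j - t (j + 1)) / w j) := by
    intro j
    have htj : 0 ≤ t j - t (j + 1) := by
      have h1 : 0 ≤ α j / c₁ * (t j - t (j + 1)) := (sq_nonneg _).trans (hdec j)
      exact nonneg_of_mul_nonneg_right h1 (div_pos (hα j) hc₁)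
    set a := c * (α j * w j)
    set b := (t j - t (j + 1)) / w j
    have ha : 0 ≤ a := by have := hα j; have := hw0 j; positivity
    have hb : 0 ≤ b := div_nonneg htj (hw0 j).le
    have hab : r ^ 2 * (α j / c₁ * (t j - t (j + 1))) = a * b := by
      rw [hrc]
      have := (hw0 j).ne'
      simp only [a, b]
      field_simp
    have h1 : (r * δ j) ^ 2 ≤ ((a + b) / 2) ^ 2 := by
      have := mul_le_mul_of_nonneg_left (hdec j) (sq_nonneg r)
      nlinarith [sq_nonneg (a - b)]
    have h2 := (le_abs_self _).trans (abs_le_of_sq_le_sq h1 (by positivity))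
    have h3 : 1 / (2 * r) * (a + b) = ((a + b) / 2) / r := by field_simp
    rw [h3, le_div_iff₀ hr, mul_comm]
    exact h2
  calc ∑ j ∈ Finset.Ico k n, δ j
      ≤ ∑ j ∈ Finset.Ico k n, 1 / (2 * r) * (c * (α j * w j) + (t j - t (j + 1)) / w j) :=
        Finset.sum_le_sum fun j _ => hδ j
    _ = 1 / (2 * r) * (c * ∑ j ∈ Finset.Ico k n, α j * w j +
          ∑ j ∈ Finset.Ico k n, (t j - t (j + 1)) / w j) := by
        rw [← Finset.mul_sum, Finset.sum_add_distrib, ← Finset.mul_sum]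
    _ ≤ 1 / (2 * r) * (desingularization φ (v k) + desingularization φ (v k)) := by
        gcongr
        linarith [hΦ0 n]
    _ = _ := by field_simp; ring

end IsErrorBoundFunction

lemma IsGlobalErrorBound.isErrorBoundFunction {d : ℕ} {S : Set (EuclideanSpace ℝ (Fin d))}
    {g h : EuclideanSpace ℝ (Fin d) → ℝ} {φ : ℝ → ℝ} {τ : ℝ} (heb : IsGlobalErrorBound S g h φ τ) :
    IsErrorBoundFunction φ τ :=
  ⟨heb.continuousOn, heb.monotoneOn, heb.pos, heb.map_zero⟩

/-! ### Measurability and boundedness of the iterates -/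

lemma ContinuousOn.measurable_comp_of_mem {Ω E : Type*} {m' : MeasurableSpace Ω}
    [TopologicalSpace E] [MeasurableSpace E] [BorelSpace E] {f : E → ℝ} {S : Set E}
    (hf : ContinuousOn f S) {X : Ω → E} (hX : Measurable X) (hXS : ∀ ω, X ω ∈ S) :
    Measurable fun ω => f (X ω) :=
  (continuousOn_iff_continuous_domRestrict.1 hf).measurable.comp (hX.subtype_mk (h := hXS))

lemma Measurable.measurableSet_le {Ω : Type*} {m' : MeasurableSpace Ω} {u v : Ω → ℝ}
    (hu : Measurable u) (hv : Measurable v) : MeasurableSet {ω | u ω ≤ v ω} :=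
  _root_.measurableSet_le hu hv

/-- The index is the first one that works; on the null set where there is none it is `0`. -/
lemma exists_measurable_index {Ω : Type*} [MeasurableSpace Ω] {μ : Measure Ω} {P : ℕ → Ω → Prop}
    (hP : ∀ k, MeasurableSet {ω | P k ω}) (h : ∀ᵐ ω ∂μ, ∀ᶠ k in atTop, P k ω) :
    ∃ K : Ω → ℕ, Measurable K ∧ ∀ᵐ ω ∂μ, ∀ k, K ω ≤ k → P k ω := by
  classical
  have hQ : ∀ N, MeasurableSet {ω | ∀ k, N ≤ k → P k ω} := fun N => by
    simp only [ofPred_forall]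
    exact MeasurableSet.iInter fun k => MeasurableSet.iInter fun _ => hP k
  have hE : MeasurableSet {ω | ∃ N, ∀ k, N ≤ k → P k ω} := by
    simp only [ofPred_exists]
    exact MeasurableSet.iUnion hQ
  let R : Ω → ℕ → Prop := fun ω N => (∀ k, N ≤ k → P k ω) ∨ ¬ ∃ N, ∀ k, N ≤ k → P k ω
  have hR : ∀ ω, ∃ N, R ω N := fun ω => by
    by_cases hω : ∃ N, ∀ k, N ≤ k → P k ω
    · exact hω.imp fun N hN => Or.inl hN
    · exact ⟨0, Or.inr hω⟩
  refine ⟨fun ω => Nat.find (hR ω), measurable_find hR fun N => (hQ N).union hE.compl, ?_⟩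
  filter_upwards [h] with ω hω
  exact (Nat.find_spec (hR ω)).resolve_right (not_not.2 (eventually_atTop.1 hω))

namespace IsMonotoneRandomizedAlgorithm

variable {Ω : Type*} [mΩ : MeasurableSpace Ω] {μ : Measure Ω} {d : ℕ}
  {x : ℕ → Ω → EuclideanSpace ℝ (Fin d)} {x₀ : EuclideanSpace ℝ (Fin d)}
  {S : Set (EuclideanSpace ℝ (Fin d))} {g h : EuclideanSpace ℝ (Fin d) → ℝ}
  {c₁ c₂ c₃ : ℝ} {α : ℕ → ℝ}

/-- The filtration generated by the iterates. -/
noncomputable def filtration (halg : IsMonotoneRandomizedAlgorithm μ x x₀ S g h c₁ c₂ c₃ α) :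
    Filtration ℕ mΩ :=
  Filtration.natural x fun i => (halg.measurable_iterate i).stronglyMeasurable

lemma measurable_filtration (halg : IsMonotoneRandomizedAlgorithm μ x x₀ S g h c₁ c₂ c₃ α)
    {k n : ℕ} (hkn : k ≤ n) : Measurable[halg.filtration n] (x k) :=
  (((Filtration.stronglyAdapted_natural fun i =>
    (halg.measurable_iterate i).stronglyMeasurable) k).measurable).mono
      (halg.filtration.mono hkn) le_rfl

lemma measurable_sq_step (halg : IsMonotoneRandomizedAlgorithm μ x x₀ S g h c₁ c₂ c₃ α) (k : ℕ) :
    Measurable[halg.filtration (k + 1)] fun ω => ‖x (k + 1) ω - x k ω‖ ^ 2 :=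
  (measurable_norm.comp ((halg.measurable_filtration le_rfl).sub
    (halg.measurable_filtration k.le_succ))).pow_const 2

lemma measurable_g (halg : IsMonotoneRandomizedAlgorithm μ x x₀ S g h c₁ c₂ c₃ α) (k : ℕ) :
    Measurable[halg.filtration k] fun ω => g (x k ω) :=
  halg.continuousOn_g.measurable_comp_of_mem (halg.measurable_filtration le_rfl) (halg.mem k)

lemma measurable_gap (halg : IsMonotoneRandomizedAlgorithm μ x x₀ S g h c₁ c₂ c₃ α) (k : ℕ) :
    Measurable[halg.filtration k] fun ω => h (x k ω) - optValue h S :=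
  (halg.continuousOn_h.measurable_comp_of_mem (halg.measurable_filtration le_rfl)
    (halg.mem k)).sub_const _

lemma exists_g_le_of_norm_le (halg : IsMonotoneRandomizedAlgorithm μ x x₀ S g h c₁ c₂ c₃ α)
    (k : ℕ) {R : ℝ} (hR : ∀ ω, ‖x k ω‖ ≤ R) : ∃ C, ∀ ω, g (x k ω) ≤ C := by
  have hc : IsCompact (S ∩ Metric.closedBall 0 R) :=
    (isCompact_closedBall (0 : EuclideanSpace ℝ (Fin d)) R).inter_left halg.isClosed
  obtain ⟨C, hC⟩ := hc.bddAbove_image (halg.continuousOn_g.mono inter_subset_left)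
  exact ⟨C, fun ω => hC (mem_image_of_mem g ⟨halg.mem k ω, by simpa using hR ω⟩)⟩

lemma exists_norm_le (halg : IsMonotoneRandomizedAlgorithm μ x x₀ S g h c₁ c₂ c₃ α) (k : ℕ) :
    ∃ R, ∀ ω, ‖x k ω‖ ≤ R := by
  induction k with
  | zero => exact ⟨‖x₀‖, fun ω => by rw [halg.init]⟩
  | succ k ih =>
    obtain ⟨R, hR⟩ := ih
    obtain ⟨C, hC⟩ := halg.exists_g_le_of_norm_le k hR
    refine ⟨R + √(c₃ * α k ^ 2 * C), fun ω => ?_⟩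
    have hc₃ : 0 < c₃ := halg.c₂_pos.trans halg.c₂_lt_c₃
    have h1 : ‖x (k + 1) ω - x k ω‖ ≤ √(c₃ * α k ^ 2 * C) := by
      refine Real.le_sqrt_of_sq_le ((halg.step_le k ω).trans ?_)
      gcongr
      exact hC ω
    calc ‖x (k + 1) ω‖ = ‖x k ω + (x (k + 1) ω - x k ω)‖ := by simp
      _ ≤ _ := (norm_add_le _ _).trans (add_le_add (hR ω) h1)

lemma exists_g_le (halg : IsMonotoneRandomizedAlgorithm μ x x₀ S g h c₁ c₂ c₃ α) (k : ℕ) :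
    ∃ C, ∀ ω, g (x k ω) ≤ C := by
  obtain ⟨R, hR⟩ := halg.exists_norm_le k
  exact halg.exists_g_le_of_norm_le k hR

lemma integrable_iterate [IsFiniteMeasure μ]
    (halg : IsMonotoneRandomizedAlgorithm μ x x₀ S g h c₁ c₂ c₃ α) (k : ℕ) :
    Integrable (x k) μ := by
  obtain ⟨R, hR⟩ := halg.exists_norm_le k
  exact Integrable.of_bound (halg.measurable_iterate k).aestronglyMeasurable R
    (Eventually.of_forall hR)

lemma integrable_sq_step [IsFiniteMeasure μ]
    (halg : IsMonotoneRandomizedAlgorithm μ x x₀ S g h c₁ c₂ c₃ α) (k : ℕ) :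
    Integrable (fun ω => ‖x (k + 1) ω - x k ω‖ ^ 2) μ := by
  obtain ⟨C, hC⟩ := halg.exists_g_le k
  have hc₃ : 0 < c₃ := halg.c₂_pos.trans halg.c₂_lt_c₃
  refine Integrable.of_bound ((halg.measurable_sq_step k).mono
    (halg.filtration.le _) le_rfl).aestronglyMeasurable (c₃ * α k ^ 2 * C)
    (Eventually.of_forall fun ω => ?_)
  rw [Real.norm_of_nonneg (by positivity)]
  refine (halg.step_le k ω).trans ?_
  gcongr
  exact hC ω

/-! ### Good steps -/

/-- The event, as an indicator, that the `k`-th squared step is at least half of the guaranteed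
conditional mean. -/
noncomputable def _root_.goodStep {Ω : Type*} {d : ℕ} (x : ℕ → Ω → EuclideanSpace ℝ (Fin d))
    (g : EuclideanSpace ℝ (Fin d) → ℝ) (c₂ : ℝ) (α : ℕ → ℝ) (k : ℕ) (ω : Ω) : ℝ :=
  {ω' | c₂ / 2 * α k ^ 2 * g (x k ω') ≤ ‖x (k + 1) ω' - x k ω'‖ ^ 2}.indicator 1 ω

lemma measurableSet_goodStep (halg : IsMonotoneRandomizedAlgorithm μ x x₀ S g h c₁ c₂ c₃ α)
    (k : ℕ) : MeasurableSet[halg.filtration (k + 1)]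
      {ω | c₂ / 2 * α k ^ 2 * g (x k ω) ≤ ‖x (k + 1) ω - x k ω‖ ^ 2} :=
  Measurable.measurableSet_le
    (((halg.measurable_g k).mono (halg.filtration.mono k.le_succ) le_rfl).const_mul _)
    (halg.measurable_sq_step k)

lemma measurable_goodStep (halg : IsMonotoneRandomizedAlgorithm μ x x₀ S g h c₁ c₂ c₃ α)
    (k : ℕ) : Measurable[halg.filtration (k + 1)] (goodStep x g c₂ α k) :=
  Measurable.indicator (m := halg.filtration (k + 1)) measurable_const
    (halg.measurableSet_goodStep k)

lemma _root_.goodStep_eq_zero_or_one {Ω : Type*} {d : ℕ} (x : ℕ → Ω → EuclideanSpace ℝ (Fin d))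
    (g : EuclideanSpace ℝ (Fin d) → ℝ) (c₂ : ℝ) (α : ℕ → ℝ) (k : ℕ) (ω : Ω) :
    goodStep x g c₂ α k ω = 0 ∨ goodStep x g c₂ α k ω = 1 := by
  unfold goodStep
  exact (indicator_eq_zero_or_self _ _ _)

/-- A reverse Markov inequality: the squared step is at most `c₃ α ^ 2 g` and has conditional mean
at least `c₂ α ^ 2 g`, so it exceeds half of the latter with conditional probability at least
`c₂ / (2 c₃ - c₂)`. -/
lemma le_condExp_goodStep [IsProbabilityMeasure μ]
    (halg : IsMonotoneRandomizedAlgorithm μ x x₀ S g h c₁ c₂ c₃ α) (k : ℕ) :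
    ∀ᵐ ω ∂μ, c₂ / (2 * c₃ - c₂) ≤ (μ[goodStep x g c₂ α k|halg.filtration k]) ω := by
  have hc₂ := halg.c₂_pos
  have hc := halg.c₂_lt_c₃
  have hα := halg.stepSize_pos k
  set ξ := goodStep x g c₂ α k with hξ
  have h01 : ∀ ω, ξ ω = 0 ∨ ξ ω = 1 := goodStep_eq_zero_or_one x g c₂ α k
  have hm := halg.filtration.le k
  have hξm : AEStronglyMeasurable ξ μ :=
    ((halg.measurable_goodStep k).mono (halg.filtration.le _) le_rfl).aestronglyMeasurable
  have hξi : Integrable ξ μ := Integrable.of_bound hξm 1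
    (Eventually.of_forall fun ω => by rcases h01 ω with h | h <;> simp [h])
  obtain ⟨C, hC⟩ := halg.exists_g_le k
  have hg0 : ∀ ω, 0 ≤ g (x k ω) := fun ω => halg.g_nonneg _ (halg.mem k ω)
  have hgm := halg.measurable_g k
  have hgm' : Measurable fun ω => g (x k ω) := hgm.mono hm le_rfl
  -- `G * ζ` bounds the squared step by `c₂ / 2 * α ^ 2 * g` off the good event, by
  -- `c₃ * α ^ 2 * g` on it
  set G : Ω → ℝ := fun ω => α k ^ 2 * g (x k ω) with hG
  have hGm : StronglyMeasurable[halg.filtration k] G := (hgm.const_mul _).stronglyMeasurable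
  have hGbd : ∀ᵐ ω ∂μ, ‖G ω‖ ≤ α k ^ 2 * C := Eventually.of_forall fun ω => by
    rw [Real.norm_of_nonneg (mul_nonneg (sq_nonneg _) (hg0 ω))]
    exact mul_le_mul_of_nonneg_left (hC ω) (sq_nonneg _)
  set ζ : Ω → ℝ := fun ω => c₂ / 2 + (c₃ - c₂ / 2) * ξ ω with hζ
  have hζi : Integrable ζ μ := (integrable_const _).add (hξi.const_mul _)
  have hGζ : Integrable (G * ζ) μ := hζi.bdd_mul (hGm.mono hm).aestronglyMeasurable hGbd
  have hle : (fun ω => ‖x (k + 1) ω - x k ω‖ ^ 2) ≤ᵐ[μ] G * ζ := Eventually.of_forall fun ω => by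
    simp only [Pi.mul_apply, hG, hζ]
    by_cases hω : c₂ / 2 * α k ^ 2 * g (x k ω) ≤ ‖x (k + 1) ω - x k ω‖ ^ 2
    · have : ξ ω = 1 := indicator_of_mem (s := {ω' | c₂ / 2 * α k ^ 2 * g (x k ω') ≤
        ‖x (k + 1) ω' - x k ω'‖ ^ 2}) hω _
      rw [this]
      have := halg.step_le k ω
      linarith
    · have : ξ ω = 0 := indicator_of_notMem (s := {ω' | c₂ / 2 * α k ^ 2 * g (x k ω') ≤
        ‖x (k + 1) ω' - x k ω'‖ ^ 2}) hω _
      rw [this]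
      have := not_le.1 hω
      linarith
  have h1 := condExp_mono (m := halg.filtration k) (halg.integrable_sq_step k) hGζ hle
  have h2 := condExp_mul_of_stronglyMeasurable_left hGm hGζ hζi
  have h3 : μ[ζ|halg.filtration k] =ᵐ[μ]
      fun ω => c₂ / 2 + (c₃ - c₂ / 2) * (μ[ξ|halg.filtration k]) ω := by
    have e1 := condExp_add (integrable_const (c₂ / 2)) (hξi.const_mul (c₃ - c₂ / 2))
      (halg.filtration k)
    have e2 := condExp_smul (μ := μ) (c₃ - c₂ / 2) ξ (halg.filtration k)
    filter_upwards [e1, e2] with ω e1 e2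
    have e3 : (μ[fun _ : Ω => c₂ / 2|halg.filtration k]) ω = c₂ / 2 := by
      rw [condExp_const hm]
    refine e1.trans ?_
    rw [Pi.add_apply, e3]
    exact congrArg _ e2
  -- where `g` vanishes, every step is good
  have h4 : (fun ω => {ω' | g (x k ω') = 0}.indicator (fun _ => (1 : ℝ)) ω) ≤ᵐ[μ]
      μ[ξ|halg.filtration k] := by
    have hms : MeasurableSet[halg.filtration k] {ω' | g (x k ω') = 0} :=
      hgm (measurableSet_singleton 0)
    have hsm : StronglyMeasurable[halg.filtration k]
        ({ω' | g (x k ω') = 0}.indicator (fun _ => (1 : ℝ))) :=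
      stronglyMeasurable_const.indicator hms
    have hint : Integrable ({ω' | g (x k ω') = 0}.indicator (fun _ => (1 : ℝ))) μ :=
      (integrable_const 1).indicator (hm _ hms)
    have := condExp_mono (m := halg.filtration k) hint hξi (Eventually.of_forall fun ω => by
      by_cases hω : g (x k ω) = 0
      · have h5 : ξ ω = 1 := indicator_of_mem (s := {ω' | c₂ / 2 * α k ^ 2 * g (x k ω') ≤
          ‖x (k + 1) ω' - x k ω'‖ ^ 2}) (by simp [hω]) _
        rw [h5]
        exact indicator_le_self' (fun _ _ => zero_le_one) ω
      · rw [indicator_of_notMem (by exact hω)]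
        rcases h01 ω with h | h <;> simp [h])
    rwa [condExp_of_stronglyMeasurable hm hsm hint] at this
  have h5 := halg.condExp_step_ge k
  filter_upwards [h1, h2, h3, h4, h5] with ω h1 h2 h3 h4 h5
  rw [div_le_iff₀ (by linarith)]
  rcases (hg0 ω).eq_or_lt with h0 | h0
  · have h6 : (1 : ℝ) ≤ (μ[ξ|halg.filtration k]) ω := by
      rwa [indicator_of_mem (by exact h0.symm)] at h4
    nlinarith
  · rw [h2, Pi.mul_apply, h3] at h1
    have h6 := h5.trans h1
    have h7 : 0 < G ω := by positivity
    have h8 : G ω * c₂ ≤ G ω * (c₂ / 2 + (c₃ - c₂ / 2) * (μ[ξ|halg.filtration k]) ω) := by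
      refine le_trans (le_of_eq ?_) h6
      simp only [hG]; ring
    have h9 := le_of_mul_le_mul_left h8 h7
    linarith

end IsMonotoneRandomizedAlgorithm

namespace IsMonotoneRandomizedAlgorithm

variable {Ω : Type*} [mΩ : MeasurableSpace Ω] {μ : Measure Ω} {d : ℕ}
  {x : ℕ → Ω → EuclideanSpace ℝ (Fin d)} {x₀ : EuclideanSpace ℝ (Fin d)}
  {S : Set (EuclideanSpace ℝ (Fin d))} {g h : EuclideanSpace ℝ (Fin d) → ℝ}
  {c₁ c₂ c₃ : ℝ} {α : ℕ → ℝ} {φ : ℝ → ℝ} {τ t₀ : ℝ}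

/-! ### Decrease of the optimality gap -/

lemma sq_step_le (halg : IsMonotoneRandomizedAlgorithm μ x x₀ S g h c₁ c₂ c₃ α) (k : ℕ) (ω : Ω) :
    ‖x (k + 1) ω - x k ω‖ ^ 2 ≤
      α k / c₁ * ((h (x k ω) - optValue h S) - (h (x (k + 1) ω) - optValue h S)) := by
  have h1 := halg.decrease k ω
  have h2 : ‖x (k + 1) ω - x k ω‖ ^ 2 =
      α k / c₁ * (c₁ / α k * ‖x (k + 1) ω - x k ω‖ ^ 2) := by
    have := (halg.stepSize_pos k).ne'
    have := halg.c₁_pos.ne'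
    field_simp
  rw [h2]
  have := halg.stepSize_pos k
  have := halg.c₁_pos
  gcongr
  linarith

lemma gap_antitone (halg : IsMonotoneRandomizedAlgorithm μ x x₀ S g h c₁ c₂ c₃ α) (ω : Ω) :
    Antitone fun k => h (x k ω) - optValue h S :=
  antitone_nat_of_succ_le fun k => by
    have h1 := halg.decrease k ω
    have h2 : 0 ≤ c₁ / α k * ‖x (k + 1) ω - x k ω‖ ^ 2 :=
      mul_nonneg (div_pos halg.c₁_pos (halg.stepSize_pos k)).le (sq_nonneg _)
    linarith

lemma gap_le_init (halg : IsMonotoneRandomizedAlgorithm μ x x₀ S g h c₁ c₂ c₃ α) (k : ℕ) (ω : Ω) :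
    h (x k ω) - optValue h S ≤ h x₀ - optValue h S := by
  have := halg.gap_antitone ω (Nat.zero_le k)
  simpa only [halg.init] using this

lemma gap_mem (halg : IsMonotoneRandomizedAlgorithm μ x x₀ S g h c₁ c₂ c₃ α)
    (heb : IsGlobalErrorBound S g h φ τ) (k : ℕ) (ω : Ω) :
    h (x k ω) - optValue h S ∈ Ico 0 τ :=
  heb.gap_mem _ (halg.mem k ω)

lemma init_mem [IsProbabilityMeasure μ]
    (halg : IsMonotoneRandomizedAlgorithm μ x x₀ S g h c₁ c₂ c₃ α) : x₀ ∈ S := by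
  obtain ⟨ω⟩ := μ.nonempty_of_neZero
  have := halg.mem 0 ω
  rwa [halg.init] at this

lemma measurable_gap' (halg : IsMonotoneRandomizedAlgorithm μ x x₀ S g h c₁ c₂ c₃ α) (k : ℕ) :
    Measurable fun ω => h (x k ω) - optValue h S :=
  (halg.measurable_gap k).mono (halg.filtration.le k) le_rfl

lemma integrable_gap [IsFiniteMeasure μ]
    (halg : IsMonotoneRandomizedAlgorithm μ x x₀ S g h c₁ c₂ c₃ α)
    (heb : IsGlobalErrorBound S g h φ τ) (k : ℕ) :
    Integrable (fun ω => h (x k ω) - optValue h S) μ := by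
  refine Integrable.of_bound (halg.measurable_gap' k).aestronglyMeasurable
    (h x₀ - optValue h S) (Eventually.of_forall fun ω => ?_)
  rw [Real.norm_of_nonneg (halg.gap_mem heb k ω).1]
  exact halg.gap_le_init k ω

/-- Along every trajectory, `Ψ` of the optimality gap grows by `c₁ c₂ α / 2` at each good step. -/
lemma invSmoothing_add_goodStep_le (halg : IsMonotoneRandomizedAlgorithm μ x x₀ S g h c₁ c₂ c₃ α)
    (heb : IsGlobalErrorBound S g h φ τ) (hφ : ¬ IntegrableNearZero τ (fun s => 1 / φ s))
    (ht₀ : t₀ ∈ Ioo 0 τ) (k : ℕ) (ω : Ω) :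
    invSmoothing φ t₀ (h x₀ - optValue h S) +
        ((c₁ * c₂ / 2 * ∑ i ∈ Finset.range k, α i * goodStep x g c₂ α i ω : ℝ) : EReal) ≤
      invSmoothing φ t₀ (h (x k ω) - optValue h S) := by
  induction k with
  | zero => simp [halg.init]
  | succ k ih =>
    have hstep : h (x (k + 1) ω) - optValue h S ≤ h (x k ω) - optValue h S -
        c₁ * c₂ / 2 * (α k * goodStep x g c₂ α k ω) * φ (h (x k ω) - optValue h S) := by
      by_cases hω : c₂ / 2 * α k ^ 2 * g (x k ω) ≤ ‖x (k + 1) ω - x k ω‖ ^ 2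
      · have h1 : goodStep x g c₂ α k ω = 1 := indicator_of_mem
          (s := {ω' | c₂ / 2 * α k ^ 2 * g (x k ω') ≤ ‖x (k + 1) ω' - x k ω'‖ ^ 2}) hω _
        rw [h1]
        have hα := halg.stepSize_pos k
        have hc₁ := halg.c₁_pos
        have hc₂ := halg.c₂_pos
        have h2 := halg.decrease k ω
        have h3 : c₁ / α k * (c₂ / 2 * α k ^ 2 * φ (h (x k ω) - optValue h S)) ≤
            c₁ / α k * ‖x (k + 1) ω - x k ω‖ ^ 2 := by
          refine mul_le_mul_of_nonneg_left (le_trans ?_ hω) (div_pos hc₁ hα).le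
          have := heb.error_bound _ (halg.mem k ω)
          gcongr
        have h4 : c₁ / α k * (c₂ / 2 * α k ^ 2 * φ (h (x k ω) - optValue h S)) =
            c₁ * c₂ / 2 * (α k * 1) * φ (h (x k ω) - optValue h S) := by
          field_simp
        linarith
      · have h1 : goodStep x g c₂ α k ω = 0 := indicator_of_notMem
          (s := {ω' | c₂ / 2 * α k ^ 2 * g (x k ω') ≤ ‖x (k + 1) ω' - x k ω'‖ ^ 2}) hω _
        rw [h1]
        have := halg.gap_antitone ω k.le_succ
        simpa using this
    have h5 := heb.isErrorBoundFunction.invSmoothing_add_le hφ ht₀ (halg.gap_mem heb k ω).2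
      (halg.gap_mem heb (k + 1) ω).1 (halg.gap_antitone ω k.le_succ) hstep
    refine le_trans ?_ h5
    rw [Finset.sum_range_succ, mul_add, EReal.coe_add, ← add_assoc]
    gcongr

/-! ### Rates for the optimality gap -/

lemma integral_gap_le [IsProbabilityMeasure μ]
    (halg : IsMonotoneRandomizedAlgorithm μ x x₀ S g h c₁ c₂ c₃ α)
    (heb : IsGlobalErrorBound S g h φ τ) (hφ : ¬ IntegrableNearZero τ (fun s => 1 / φ s))
    (ht₀ : t₀ ∈ Ioo 0 τ) {p : ℝ} (hp : p = c₂ / (2 * c₃ - c₂)) {A : ℝ} (hA : 0 < A)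
    (hαA : ∀ k, α k ≤ A) (k : ℕ) :
    invSmoothing φ t₀ (h x₀ - optValue h S) +
        ((c₁ * c₂ * p / 4 * ∑ i ∈ Finset.range k, α i : ℝ) : EReal) ∈ invSmoothingRange φ τ t₀ ∧
    ∫ ω, (h (x k ω) - optValue h S) ∂μ ≤
      Real.exp (-(p ^ 2 / (2 * A)) * ∑ i ∈ Finset.range k, α i) * (h x₀ - optValue h S) +
      invSmoothingInv φ τ t₀ (invSmoothing φ t₀ (h x₀ - optValue h S) +
        ((c₁ * c₂ * p / 4 * ∑ i ∈ Finset.range k, α i : ℝ) : EReal)) := by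
  have H := heb.isErrorBoundFunction
  have hc₁ := halg.c₁_pos
  have hc₂ := halg.c₂_pos
  have hc₃ := halg.c₂_lt_c₃
  have hp0 : 0 < p := by rw [hp]; exact div_pos hc₂ (by linarith)
  have hp1 : p ≤ 1 := by rw [hp, div_le_one (by linarith)]; linarith
  have hT₀ := heb.gap_mem x₀ halg.init_mem
  set T₀ := h x₀ - optValue h S
  set s := ∑ i ∈ Finset.range k, α i with hs
  have hs0 : 0 ≤ s := Finset.sum_nonneg fun i _ => (halg.stepSize_pos i).le
  have hmem : invSmoothing φ t₀ T₀ + ((c₁ * c₂ * p / 4 * s : ℝ) : EReal) ∈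
      invSmoothingRange φ τ t₀ := by
    refine H.mem_invSmoothingRange_of_le hφ ht₀ hT₀ (le_add_of_nonneg_right ?_)
    exact_mod_cast (by positivity : 0 ≤ c₁ * c₂ * p / 4 * s)
  refine ⟨hmem, ?_⟩
  set u := invSmoothingInv φ τ t₀ (invSmoothing φ t₀ T₀ + ((c₁ * c₂ * p / 4 * s : ℝ) : EReal))
  have hu := invSmoothingInv_mem hmem
  -- the event of too few good steps
  set B : Set Ω := {ω | ∑ i ∈ Finset.range k, α i * goodStep x g c₂ α i ω ≤ (p - p / 2) * s}
  have hBm : MeasurableSet B := measurableSet_le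
    ((measurable_weighted_sum halg.measurable_goodStep k).mono (halg.filtration.le k) le_rfl)
    measurable_const
  have hB := measureReal_weighted_sum_le (μ := μ) halg.measurable_goodStep
    (goodStep_eq_zero_or_one x g c₂ α) (p := p) (fun k => hp ▸ halg.le_condExp_goodStep k)
    hp0.le hp1 (fun k => (halg.stepSize_pos k).le) hA hαA (half_pos hp0).le k
  have hle : ∀ ω, h (x k ω) - optValue h S ≤ B.indicator (fun _ => T₀) ω + u := by
    intro ω
    by_cases hω : ω ∈ B
    · rw [indicator_of_mem hω]
      linarith [halg.gap_le_init k ω, hu.1]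
    · rw [indicator_of_notMem hω, zero_add,
        H.le_invSmoothingInv_iff hφ ht₀ (halg.gap_mem heb k ω) hmem]
      refine le_trans ?_ (halg.invSmoothing_add_goodStep_le heb hφ ht₀ k ω)
      have h1 : (p - p / 2) * s < ∑ i ∈ Finset.range k, α i * goodStep x g c₂ α i ω := not_le.1 hω
      have h2 : c₁ * c₂ * p / 4 * s ≤
          c₁ * c₂ / 2 * ∑ i ∈ Finset.range k, α i * goodStep x g c₂ α i ω := by
        have : 0 < c₁ * c₂ := mul_pos hc₁ hc₂
        nlinarith
      gcongr
  have hint : Integrable (B.indicator fun _ => T₀) μ := (integrable_const _).indicator hBm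
  calc ∫ ω, (h (x k ω) - optValue h S) ∂μ ≤ ∫ ω, (B.indicator (fun _ => T₀) ω + u) ∂μ :=
        integral_mono (halg.integrable_gap heb k) (hint.add (integrable_const _)) hle
    _ = μ.real B * T₀ + u := by
        rw [integral_add hint (integrable_const _), integral_indicator_const _ hBm]
        simp
    _ ≤ Real.exp (-(p ^ 2 / (2 * A)) * s) * T₀ + u := by
        gcongr
        · exact hT₀.1
        · refine hB.trans (le_of_eq ?_)
          congr 2
          ring

lemma ae_eventually_gap_le [IsProbabilityMeasure μ]
    (halg : IsMonotoneRandomizedAlgorithm μ x x₀ S g h c₁ c₂ c₃ α)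
    (heb : IsGlobalErrorBound S g h φ τ) (hφ : ¬ IntegrableNearZero τ (fun s => 1 / φ s))
    (ht₀ : t₀ ∈ Ioo 0 τ) {p : ℝ} (hp : p = c₂ / (2 * c₃ - c₂)) {A : ℝ} (hA : 0 < A)
    (hαA : ∀ k, α k ≤ A) (hsum : Tendsto (fun k => ∑ i ∈ Finset.range k, α i) atTop atTop) :
    ∀ᵐ ω ∂μ, ∀ᶠ k in atTop, h (x k ω) - optValue h S ≤ invSmoothingInv φ τ t₀
      ((c₁ * c₂ * p / 3 * ∑ i ∈ Finset.range k, α i : ℝ) : EReal) := by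
  have H := heb.isErrorBoundFunction
  have hc₁ := halg.c₁_pos
  have hc₂ := halg.c₂_pos
  have hc₃ := halg.c₂_lt_c₃
  have hp0 : 0 < p := by rw [hp]; exact div_pos hc₂ (by linarith)
  have hp1 : p ≤ 1 := by rw [hp, div_le_one (by linarith)]; linarith
  have hcp : 0 < c₁ * c₂ * p := by positivity
  obtain ⟨b, hb⟩ := H.exists_coe_le_invSmoothing hφ ht₀ (heb.gap_mem x₀ halg.init_mem)
  -- `3 / 4 * 1 / 2` exceeds `1 / 3`, which leaves room for the initial value of `Ψ`
  have hev := ae_eventually_mul_le_weighted_sum (μ := μ) halg.measurable_goodStep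
    (goodStep_eq_zero_or_one x g c₂ α) (p := p) (fun k => hp ▸ halg.le_condExp_goodStep k) hp1
    (fun k => (halg.stepSize_pos k).le) hA hαA hsum (q := 3 / 4 * p) (by positivity) (by linarith)
  filter_upwards [hev] with ω hω
  filter_upwards [hω, hsum.eventually_ge_atTop (-b * 24 / (c₁ * c₂ * p))] with k hk hk2
  set s := ∑ i ∈ Finset.range k, α i with hs
  have hs0 : 0 ≤ s := Finset.sum_nonneg fun i _ => (halg.stepSize_pos i).le
  rw [H.le_invSmoothingInv_iff hφ ht₀ (halg.gap_mem heb k ω)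
    (H.coe_mem_invSmoothingRange hφ ht₀ (by positivity))]
  refine le_trans ?_ ((add_le_add_left hb _).trans
    (halg.invSmoothing_add_goodStep_le heb hφ ht₀ k ω))
  rw [← EReal.coe_add, EReal.coe_le_coe_iff]
  rw [div_le_iff₀ hcp] at hk2
  have : 0 < c₁ * c₂ := mul_pos hc₁ hc₂
  nlinarith

lemma exists_measurable_index_gap_le [IsProbabilityMeasure μ]
    (halg : IsMonotoneRandomizedAlgorithm μ x x₀ S g h c₁ c₂ c₃ α)
    (heb : IsGlobalErrorBound S g h φ τ) (hφ : ¬ IntegrableNearZero τ (fun s => 1 / φ s))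
    (ht₀ : t₀ ∈ Ioo 0 τ) {p : ℝ} (hp : p = c₂ / (2 * c₃ - c₂)) {A : ℝ} (hA : 0 < A)
    (hαA : ∀ k, α k ≤ A) (hsum : Tendsto (fun k => ∑ i ∈ Finset.range k, α i) atTop atTop) :
    ∃ K : Ω → ℕ, Measurable K ∧ ∀ᵐ ω ∂μ, ∀ k, K ω ≤ k →
      h (x k ω) - optValue h S ≤ invSmoothingInv φ τ t₀
        ((c₁ * c₂ * p / 3 * ∑ i ∈ Finset.range k, α i : ℝ) : EReal) :=
  exists_measurable_index (fun k => measurableSet_le (halg.measurable_gap' k) measurable_const)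
    (halg.ae_eventually_gap_le heb hφ ht₀ hp hA hαA hsum)

lemma ae_tendsto_gap [IsProbabilityMeasure μ]
    (halg : IsMonotoneRandomizedAlgorithm μ x x₀ S g h c₁ c₂ c₃ α)
    (heb : IsGlobalErrorBound S g h φ τ) (hφ : ¬ IntegrableNearZero τ (fun s => 1 / φ s))
    {A : ℝ} (hA : 0 < A) (hαA : ∀ k, α k ≤ A)
    (hsum : Tendsto (fun k => ∑ i ∈ Finset.range k, α i) atTop atTop) :
    ∀ᵐ ω ∂μ, Tendsto (fun k => h (x k ω) - optValue h S) atTop (𝓝 0) := by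
  have ht₀ : τ / 2 ∈ Ioo 0 τ := ⟨half_pos heb.τ_pos, half_lt_self heb.τ_pos⟩
  have hc₁ := halg.c₁_pos
  have hc₂ := halg.c₂_pos
  have hc₃ := halg.c₂_lt_c₃
  have hp0 : 0 < c₂ / (2 * c₃ - c₂) := div_pos hc₂ (by linarith)
  filter_upwards [halg.ae_eventually_gap_le heb hφ ht₀ rfl hA hαA hsum] with ω hω
  refine tendsto_of_tendsto_of_tendsto_of_le_of_le' tendsto_const_nhds
    ((heb.isErrorBoundFunction.tendsto_invSmoothingInv hφ ht₀).comp
      (hsum.const_mul_atTop (by positivity : 0 < c₁ * c₂ * (c₂ / (2 * c₃ - c₂)) / 3)))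
    (Eventually.of_forall fun k => (halg.gap_mem heb k ω).1) hω

/-! ### Convergence of the iterates -/

lemma measurable_desingularization_gap
    (halg : IsMonotoneRandomizedAlgorithm μ x x₀ S g h c₁ c₂ c₃ α)
    (heb : IsGlobalErrorBound S g h φ τ) (hΦ : IntegrableNearZero τ (fun s => 1 / √(φ s)))
    (hx₀ : x₀ ∈ S) (k : ℕ) :
    Measurable fun ω => desingularization φ (h (x k ω) - optValue h S) :=
  (heb.isErrorBoundFunction.continuousOn_desingularization hΦ
    (heb.gap_mem x₀ hx₀)).measurable_comp_of_mem (halg.measurable_gap' k)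
      fun ω => ⟨(halg.gap_mem heb k ω).1, halg.gap_le_init k ω⟩

lemma desingularization_gap_nonneg
    (halg : IsMonotoneRandomizedAlgorithm μ x x₀ S g h c₁ c₂ c₃ α)
    (heb : IsGlobalErrorBound S g h φ τ) (hΦ : IntegrableNearZero τ (fun s => 1 / √(φ s)))
    (k : ℕ) (ω : Ω) : 0 ≤ desingularization φ (h (x k ω) - optValue h S) := by
  simpa using heb.isErrorBoundFunction.monotoneOn_desingularization hΦ ⟨le_rfl, heb.τ_pos⟩
    (halg.gap_mem heb k ω) (halg.gap_mem heb k ω).1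

lemma norm_desingularization_gap_le
    (halg : IsMonotoneRandomizedAlgorithm μ x x₀ S g h c₁ c₂ c₃ α)
    (heb : IsGlobalErrorBound S g h φ τ) (hΦ : IntegrableNearZero τ (fun s => 1 / √(φ s)))
    (hx₀ : x₀ ∈ S) (k : ℕ) (ω : Ω) :
    ‖desingularization φ (h (x k ω) - optValue h S)‖ ≤
      desingularization φ (h x₀ - optValue h S) := by
  rw [Real.norm_of_nonneg (halg.desingularization_gap_nonneg heb hΦ k ω)]
  exact heb.isErrorBoundFunction.monotoneOn_desingularization hΦ (halg.gap_mem heb k ω)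
    (heb.gap_mem x₀ hx₀) (halg.gap_le_init k ω)

lemma integrable_desingularization_gap [IsProbabilityMeasure μ]
    (halg : IsMonotoneRandomizedAlgorithm μ x x₀ S g h c₁ c₂ c₃ α)
    (heb : IsGlobalErrorBound S g h φ τ) (hΦ : IntegrableNearZero τ (fun s => 1 / √(φ s)))
    (k : ℕ) : Integrable (fun ω => desingularization φ (h (x k ω) - optValue h S)) μ :=
  Integrable.of_bound
    (halg.measurable_desingularization_gap heb hΦ halg.init_mem k).aestronglyMeasurable _
    (Eventually.of_forall (halg.norm_desingularization_gap_le heb hΦ halg.init_mem k))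

/-- The expected step length is controlled by the expected decrease of `Φ` of the optimality gap.
The step is at most of order `α √g ≤ α g / √φ`, and the lower bound on the conditional second moment
bounds `α ^ 2 g` by the mean squared step, hence by the decrease of the gap; dividing by `√φ` turns
it into a decrease of `Φ`. -/
lemma integral_norm_step_le [IsProbabilityMeasure μ]
    (halg : IsMonotoneRandomizedAlgorithm μ x x₀ S g h c₁ c₂ c₃ α)
    (heb : IsGlobalErrorBound S g h φ τ) (hΦ : IntegrableNearZero τ (fun s => 1 / √(φ s)))
    (k : ℕ) :
    ∫ ω, ‖x (k + 1) ω - x k ω‖ ∂μ ≤ √c₃ / (c₁ * c₂) *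
      (∫ ω, desingularization φ (h (x k ω) - optValue h S) ∂μ -
        ∫ ω, desingularization φ (h (x (k + 1) ω) - optValue h S) ∂μ) := by
  have H := heb.isErrorBoundFunction
  have hc₁ := halg.c₁_pos
  have hc₂ := halg.c₂_pos
  have hc₃ : 0 < c₃ := hc₂.trans halg.c₂_lt_c₃
  have hα := halg.stepSize_pos k
  have hm := halg.filtration.le k
  set D : Ω → ℝ := fun ω => ‖x (k + 1) ω - x k ω‖ ^ 2 with hD
  set Z : Ω → ℝ := fun ω => 1 / √(φ (h (x k ω) - optValue h S)) with hZ
  have hZ0 : ∀ ω, 0 ≤ Z ω := fun ω => by positivity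
  have hg0 : ∀ ω, 0 ≤ g (x k ω) := fun ω => halg.g_nonneg _ (halg.mem k ω)
  have hZm : Measurable[halg.filtration k] Z := by
    have h1 : Measurable[halg.filtration k] fun ω => φ (h (x k ω) - optValue h S) :=
      heb.continuousOn.measurable_comp_of_mem (halg.measurable_gap k) (halg.gap_mem heb k)
    exact (Real.continuous_sqrt.measurable.comp h1).const_div 1
  have hDi : Integrable D μ := halg.integrable_sq_step k
  have hΦi := halg.integrable_desingularization_gap heb hΦ
  have hZD : ∀ ω, Z ω * D ω ≤ α k / c₁ * (desingularization φ (h (x k ω) - optValue h S) -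
      desingularization φ (h (x (k + 1) ω) - optValue h S)) := by
    intro ω
    have h1 := H.sub_div_sqrt_le hΦ (halg.gap_mem heb (k + 1) ω).1
      (halg.gap_antitone ω k.le_succ) (halg.gap_mem heb k ω).2
    calc Z ω * D ω ≤ Z ω * (α k / c₁ *
          ((h (x k ω) - optValue h S) - (h (x (k + 1) ω) - optValue h S))) :=
          mul_le_mul_of_nonneg_left (halg.sq_step_le k ω) (hZ0 ω)
      _ = α k / c₁ * (((h (x k ω) - optValue h S) - (h (x (k + 1) ω) - optValue h S)) /
          √(φ (h (x k ω) - optValue h S))) := by rw [hZ]; ring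
      _ ≤ _ := mul_le_mul_of_nonneg_left h1 (div_pos hα hc₁).le
  have hΦd : Integrable (fun ω => α k / c₁ * (desingularization φ (h (x k ω) - optValue h S) -
      desingularization φ (h (x (k + 1) ω) - optValue h S))) μ :=
    ((hΦi k).sub (hΦi (k + 1))).const_mul _
  have hZDi : Integrable (Z * D) μ := hΦd.mono'
    ((hZm.mono hm le_rfl).aestronglyMeasurable.mul hDi.aestronglyMeasurable)
    (Eventually.of_forall fun ω => by
      rw [Pi.mul_apply, Real.norm_of_nonneg (mul_nonneg (hZ0 ω) (sq_nonneg _))]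
      exact hZD ω)
  have hpull := condExp_mul_of_stronglyMeasurable_left hZm.stronglyMeasurable hZDi hDi
  set W : Ω → ℝ := fun ω => Z ω * (c₂ * α k ^ 2 * g (x k ω)) with hW
  have hW0 : ∀ ω, 0 ≤ W ω := fun ω => by have := hZ0 ω; have := hg0 ω; positivity
  have hWle : W ≤ᵐ[μ] μ[Z * D|halg.filtration k] := by
    filter_upwards [hpull, halg.condExp_step_ge k] with ω h1 h2
    rw [h1]
    exact mul_le_mul_of_nonneg_left h2 (hZ0 ω)
  have hWi : Integrable W μ := by
    refine (integrable_condExp (f := Z * D) (m := halg.filtration k)).mono' ?_ ?_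
    · exact ((hZm.mul ((halg.measurable_g k).const_mul _)).mono hm le_rfl).aestronglyMeasurable
    · filter_upwards [hWle] with ω hω
      rwa [Real.norm_of_nonneg (hW0 ω)]
  have hstep : ∀ ω, ‖x (k + 1) ω - x k ω‖ ≤ √c₃ / (c₂ * α k) * W ω := by
    intro ω
    have hgap := halg.gap_mem heb k ω
    rcases hgap.1.eq_or_lt with h0 | h0
    · have h1 := halg.sq_step_le k ω
      have h2 := (halg.gap_mem heb (k + 1) ω).1
      have h3 : ‖x (k + 1) ω - x k ω‖ ^ 2 ≤ 0 := by
        refine h1.trans (mul_nonpos_of_nonneg_of_nonpos (div_pos hα hc₁).le ?_)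
        linarith
      have h4 : ‖x (k + 1) ω - x k ω‖ = 0 := by
        exact pow_eq_zero_iff two_ne_zero |>.1 (le_antisymm h3 (sq_nonneg _))
      rw [h4]
      have := hW0 ω
      positivity
    · have h1 := H.pos _ ⟨h0, hgap.2⟩
      have h2 := Real.sqrt_pos.2 h1
      have h3 := Real.sqrt_le_sqrt (heb.error_bound _ (halg.mem k ω))
      calc ‖x (k + 1) ω - x k ω‖ ≤ √(c₃ * α k ^ 2 * g (x k ω)) :=
            Real.le_sqrt_of_sq_le (halg.step_le k ω)
        _ = √c₃ * α k * √(g (x k ω)) := by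
            rw [Real.sqrt_mul (by positivity), Real.sqrt_mul hc₃.le, Real.sqrt_sq hα.le]
        _ ≤ √c₃ * α k * (g (x k ω) / √(φ (h (x k ω) - optValue h S))) := by
            gcongr
            rw [le_div_iff₀ h2]
            calc _ ≤ √(g (x k ω)) * √(g (x k ω)) := by gcongr
              _ = _ := Real.mul_self_sqrt (hg0 ω)
        _ = √c₃ / (c₂ * α k) * W ω := by
            simp only [hW, hZ]
            field_simp
  have hni : Integrable (fun ω => ‖x (k + 1) ω - x k ω‖) μ :=
    ((halg.integrable_iterate (k + 1)).sub (halg.integrable_iterate k)).norm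
  calc ∫ ω, ‖x (k + 1) ω - x k ω‖ ∂μ ≤ ∫ ω, √c₃ / (c₂ * α k) * W ω ∂μ :=
        integral_mono hni (hWi.const_mul _) hstep
    _ = √c₃ / (c₂ * α k) * ∫ ω, W ω ∂μ := integral_const_mul _ _
    _ ≤ √c₃ / (c₂ * α k) * ∫ ω, (μ[Z * D|halg.filtration k]) ω ∂μ := by
        exact mul_le_mul_of_nonneg_left (integral_mono_ae hWi integrable_condExp hWle)
          (by positivity)
    _ = √c₃ / (c₂ * α k) * ∫ ω, (Z * D) ω ∂μ := by rw [integral_condExp hm]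
    _ ≤ √c₃ / (c₂ * α k) * ∫ ω, α k / c₁ *
          (desingularization φ (h (x k ω) - optValue h S) -
            desingularization φ (h (x (k + 1) ω) - optValue h S)) ∂μ := by
        exact mul_le_mul_of_nonneg_left (integral_mono hZDi hΦd hZD) (by positivity)
    _ = _ := by
        rw [integral_const_mul, integral_sub (hΦi k) (hΦi (k + 1))]
        field_simp

/-- Jensen's inequality for the concave function `Φ` and the optimality gap. -/
lemma integral_desingularization_gap_le [IsProbabilityMeasure μ]
    (halg : IsMonotoneRandomizedAlgorithm μ x x₀ S g h c₁ c₂ c₃ α)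
    (heb : IsGlobalErrorBound S g h φ τ) (hΦ : IntegrableNearZero τ (fun s => 1 / √(φ s)))
    (k : ℕ) :
    ∫ ω, desingularization φ (h (x k ω) - optValue h S) ∂μ ≤
      desingularization φ (∫ ω, (h (x k ω) - optValue h S) ∂μ) := by
  have H := heb.isErrorBoundFunction
  have hi := halg.integrable_gap heb k
  have hnn : ∀ ω, 0 ≤ h (x k ω) - optValue h S := fun ω => (halg.gap_mem heb k ω).1
  set m := ∫ ω, (h (x k ω) - optValue h S) ∂μ with hm
  have hm0 : 0 ≤ m := integral_nonneg hnn
  rcases hm0.eq_or_lt with h0 | h0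
  · have h1 : (fun ω => h (x k ω) - optValue h S) =ᵐ[μ] 0 :=
      (integral_eq_zero_iff_of_nonneg hnn hi).1 h0.symm
    rw [← h0, desingularization_zero]
    refine le_of_eq (integral_eq_zero_of_ae (h1.mono fun ω hω => ?_))
    simp only [Pi.zero_apply] at hω ⊢
    rw [hω, desingularization_zero]
  · have hmτ : m < τ := by
      refine lt_of_le_of_lt ?_ (heb.gap_mem x₀ halg.init_mem).2
      have := integral_mono hi (integrable_const (h x₀ - optValue h S)) (halg.gap_le_init k)
      simpa using this
    have hi' : Integrable (fun ω => (h (x k ω) - optValue h S - m) / √(φ m)) μ :=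
      (hi.sub (integrable_const m)).div_const _
    have h1 := integral_mono (halg.integrable_desingularization_gap heb hΦ k)
      ((integrable_const (desingularization φ m)).add hi')
      (fun ω => H.desingularization_le_tangent hΦ ⟨h0, hmτ⟩ (halg.gap_mem heb k ω))
    refine h1.trans (le_of_eq ?_)
    simp only [Pi.add_apply]
    rw [integral_add (integrable_const _) hi', integral_div,
      integral_sub hi (integrable_const _), ← hm]
    simp

lemma sum_Ico_integral_norm_step_le [IsProbabilityMeasure μ]
    (halg : IsMonotoneRandomizedAlgorithm μ x x₀ S g h c₁ c₂ c₃ α)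
    (heb : IsGlobalErrorBound S g h φ τ) (hΦ : IntegrableNearZero τ (fun s => 1 / √(φ s)))
    {k n : ℕ} (hkn : k ≤ n) :
    ∑ j ∈ Finset.Ico k n, ∫ ω, ‖x (j + 1) ω - x j ω‖ ∂μ ≤ √c₃ / (c₁ * c₂) *
      ∫ ω, desingularization φ (h (x k ω) - optValue h S) ∂μ := by
  have hc₁ := halg.c₁_pos
  have hc₂ := halg.c₂_pos
  have key : ∑ j ∈ Finset.Ico k n, ∫ ω, ‖x (j + 1) ω - x j ω‖ ∂μ ≤ √c₃ / (c₁ * c₂) *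
      (∫ ω, desingularization φ (h (x k ω) - optValue h S) ∂μ -
        ∫ ω, desingularization φ (h (x n ω) - optValue h S) ∂μ) := by
    induction n, hkn using Nat.le_induction with
    | base => simp
    | succ n hn ih =>
      rw [Finset.sum_Ico_succ_top hn]
      linarith [halg.integral_norm_step_le heb hΦ n]
  refine key.trans (mul_le_mul_of_nonneg_left ?_ (by positivity))
  have : 0 ≤ ∫ ω, desingularization φ (h (x n ω) - optValue h S) ∂μ :=
    integral_nonneg (halg.desingularization_gap_nonneg heb hΦ n)
  linarith

lemma integrable_norm_step [IsFiniteMeasure μ]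
    (halg : IsMonotoneRandomizedAlgorithm μ x x₀ S g h c₁ c₂ c₃ α) (k : ℕ) :
    Integrable (fun ω => ‖x (k + 1) ω - x k ω‖) μ :=
  ((halg.integrable_iterate (k + 1)).sub (halg.integrable_iterate k)).norm

lemma exists_ae_tendsto [IsProbabilityMeasure μ]
    (halg : IsMonotoneRandomizedAlgorithm μ x x₀ S g h c₁ c₂ c₃ α)
    (heb : IsGlobalErrorBound S g h φ τ) (hΦ : IntegrableNearZero τ (fun s => 1 / √(φ s))) :
    ∃ xs : Ω → EuclideanSpace ℝ (Fin d), Measurable xs ∧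
      ∀ᵐ ω ∂μ, Tendsto (fun k => x k ω) atTop (𝓝 (xs ω)) := by
  have hsm : Summable fun k => ∫ ω, ‖x (k + 1) ω - x k ω‖ ∂μ :=
    summable_of_sum_range_le (fun k => integral_nonneg fun ω => norm_nonneg _) fun n => by
      have := halg.sum_Ico_integral_norm_step_le heb hΦ (Nat.zero_le n)
      rwa [← Finset.range_eq_Ico] at this
  have hmeas : ∀ k, Measurable fun ω => x (k + 1) ω - x k ω := fun k =>
    (halg.measurable_iterate _).sub (halg.measurable_iterate _)
  have hfin : ∫⁻ ω, ∑' k, ‖x (k + 1) ω - x k ω‖ₑ ∂μ ≠ ⊤ := by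
    rw [lintegral_tsum fun k => (hmeas k).enorm.aemeasurable]
    have : ∀ k, ∫⁻ ω, ‖x (k + 1) ω - x k ω‖ₑ ∂μ =
        ENNReal.ofReal (∫ ω, ‖x (k + 1) ω - x k ω‖ ∂μ) := fun k =>
      (ofReal_integral_norm_eq_lintegral_enorm
        ((halg.integrable_iterate (k + 1)).sub (halg.integrable_iterate k))).symm
    simp_rw [this]
    exact hsm.tsum_ofReal_ne_top
  have hlim : ∀ᵐ ω ∂μ, ∃ l, Tendsto (fun k => x k ω) atTop (𝓝 l) := by
    filter_upwards [ae_lt_top (Measurable.tsum fun k => (hmeas k).enorm) hfin] with ω hω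
    refine cauchySeq_tendsto_of_complete (cauchySeq_of_summable_dist ?_)
    have h1 : Summable fun k => ‖x (k + 1) ω - x k ω‖₊ :=
      ENNReal.tsum_coe_ne_top_iff_summable.1 hω.ne
    simpa [dist_eq_norm, norm_sub_rev] using NNReal.summable_coe.2 h1
  exact measurable_limit_of_tendsto_metrizable_ae
    (fun k => (halg.measurable_iterate k).aemeasurable) hlim

lemma eLpNorm_sub_limit_le [IsProbabilityMeasure μ]
    (halg : IsMonotoneRandomizedAlgorithm μ x x₀ S g h c₁ c₂ c₃ α)
    (heb : IsGlobalErrorBound S g h φ τ) (hΦ : IntegrableNearZero τ (fun s => 1 / √(φ s)))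
    {xs : Ω → EuclideanSpace ℝ (Fin d)}
    (hlim : ∀ᵐ ω ∂μ, Tendsto (fun k => x k ω) atTop (𝓝 (xs ω))) (k : ℕ) :
    eLpNorm (x k - xs) 1 μ ≤ ENNReal.ofReal (√c₃ / (c₁ * c₂) *
      ∫ ω, desingularization φ (h (x k ω) - optValue h S) ∂μ) := by
  have h1 := Lp.eLpNorm_lim_le_liminf_eLpNorm (μ := μ) (p := 1) (f := fun n => x k - x n)
    (fun n => ((halg.measurable_iterate k).sub (halg.measurable_iterate n)).aestronglyMeasurable)
    (x k - xs) (hlim.mono fun ω hω => hω.const_sub (x k ω))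
  refine h1.trans (liminf_le_of_frequently_le'
    (Eventually.frequently ((eventually_ge_atTop k).mono fun n hn => ?_)))
  rw [eLpNorm_one_eq_lintegral_enorm, ← ofReal_integral_norm_eq_lintegral_enorm
    ((halg.integrable_iterate k).sub (halg.integrable_iterate n))]
  refine ENNReal.ofReal_le_ofReal (le_trans ?_ (halg.sum_Ico_integral_norm_step_le heb hΦ hn))
  rw [← integral_finsetSum _ fun j _ => halg.integrable_norm_step j]
  refine integral_mono ((halg.integrable_iterate k).sub (halg.integrable_iterate n)).norm
    (integrable_finsetSum _ fun j _ => halg.integrable_norm_step j) fun ω => ?_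
  have := dist_le_Ico_sum_dist (fun j => x j ω) hn
  simpa [dist_eq_norm, norm_sub_rev] using this

lemma tendsto_integral_desingularization_gap [IsProbabilityMeasure μ]
    (halg : IsMonotoneRandomizedAlgorithm μ x x₀ S g h c₁ c₂ c₃ α)
    (heb : IsGlobalErrorBound S g h φ τ) (hΦ : IntegrableNearZero τ (fun s => 1 / √(φ s)))
    (hgap : ∀ᵐ ω ∂μ, Tendsto (fun k => h (x k ω) - optValue h S) atTop (𝓝 0)) :
    Tendsto (fun k => ∫ ω, desingularization φ (h (x k ω) - optValue h S) ∂μ) atTop (𝓝 0) := by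
  have hT₀ := heb.gap_mem x₀ halg.init_mem
  rw [← integral_zero Ω ℝ (μ := μ)]
  refine tendsto_integral_of_dominated_convergence
    (fun _ => desingularization φ (h x₀ - optValue h S))
    (fun k => (halg.integrable_desingularization_gap heb hΦ k).aestronglyMeasurable)
    (integrable_const _)
    (fun k => Eventually.of_forall (halg.norm_desingularization_gap_le heb hΦ halg.init_mem k)) ?_
  filter_upwards [hgap] with ω hω
  have hc := heb.isErrorBoundFunction.continuousOn_desingularization hΦ hT₀ 0 ⟨le_rfl, hT₀.1⟩
  have h1 := hc.tendsto.comp (tendsto_nhdsWithin_iff.2 ⟨hω, Eventually.of_forall fun k =>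
    ⟨(halg.gap_mem heb k ω).1, halg.gap_le_init k ω⟩⟩)
  simpa [Function.comp_def] using h1

lemma mem_and_isMinOn_of_tendsto (halg : IsMonotoneRandomizedAlgorithm μ x x₀ S g h c₁ c₂ c₃ α)
    {ω : Ω} {y : EuclideanSpace ℝ (Fin d)} (hy : Tendsto (fun k => x k ω) atTop (𝓝 y))
    (hgap : Tendsto (fun k => h (x k ω) - optValue h S) atTop (𝓝 0)) : y ∈ S ∧ IsMinOn h S y := by
  have hyS : y ∈ S := halg.isClosed.mem_of_tendsto hy (Eventually.of_forall fun k => halg.mem k ω)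
  have h1 : Tendsto (fun k => h (x k ω)) atTop (𝓝 (h y)) :=
    (halg.continuousOn_h y hyS).tendsto.comp (tendsto_nhdsWithin_iff.2
      ⟨hy, Eventually.of_forall fun k => halg.mem k ω⟩)
  have h2 : h y - optValue h S = 0 := tendsto_nhds_unique (h1.sub_const _) hgap
  refine ⟨hyS, fun z hz => ?_⟩
  have h3 : optValue h S ≤ h z := csInf_le halg.bddBelow_h (mem_image_of_mem h hz)
  change h y ≤ h z
  linarith

/-- The almost sure rate of the gap gives the almost sure rate of the iterates: since
`α k = o(∑_{i ≤ k} α i)`, the constant `1 / 3` may be replaced by `1 / 4` after shifting the index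
by one. -/
lemma exists_measurable_index_norm_sub_limit_le [IsProbabilityMeasure μ]
    (halg : IsMonotoneRandomizedAlgorithm μ x x₀ S g h c₁ c₂ c₃ α)
    (heb : IsGlobalErrorBound S g h φ τ) (hφ : ¬ IntegrableNearZero τ (fun s => 1 / φ s))
    (hΦ : IntegrableNearZero τ (fun s => 1 / √(φ s)))
    (ht₀ : t₀ ∈ Ioo 0 τ) {p : ℝ} (hp : p = c₂ / (2 * c₃ - c₂)) {A : ℝ} (hA : 0 < A)
    (hαA : ∀ k, α k ≤ A) (hsum : Tendsto (fun k => ∑ i ∈ Finset.range k, α i) atTop atTop)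
    {xs : Ω → EuclideanSpace ℝ (Fin d)}
    (hlim : ∀ᵐ ω ∂μ, Tendsto (fun k => x k ω) atTop (𝓝 (xs ω))) :
    ∃ K : Ω → ℕ, Measurable K ∧ ∀ᵐ ω ∂μ, ∀ k, K ω ≤ k →
      ‖x k ω - xs ω‖ ≤ 4 / (c₁ * √(c₂ * p)) * desingularization φ (invSmoothingInv φ τ t₀
        ((c₁ * c₂ * p / 4 * ∑ i ∈ Finset.range k, α i : ℝ) : EReal)) := by
  have H := heb.isErrorBoundFunction
  have hc₁ := halg.c₁_pos
  have hc₂ := halg.c₂_pos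
  have hc₃ := halg.c₂_lt_c₃
  have hp0 : 0 < p := by rw [hp]; exact div_pos hc₂ (by linarith)
  have hcp : 0 < c₁ * c₂ * p := by positivity
  have hs0 : ∀ k, 0 ≤ ∑ i ∈ Finset.range k, α i := fun k =>
    Finset.sum_nonneg fun i _ => (halg.stepSize_pos i).le
  obtain ⟨K, hK, hKle⟩ := halg.exists_measurable_index_gap_le heb hφ ht₀ hp hA hαA hsum
  -- `(s + α) / 4 ≤ s / 3` holds as soon as `3 α ≤ s`
  obtain ⟨N, hN⟩ := eventually_atTop.1 (hsum.eventually_ge_atTop (3 * A))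
  refine ⟨fun ω => max (K ω) N, hK.max measurable_const, ?_⟩
  filter_upwards [hKle, hlim] with ω hω hx k hk
  set r := c₁ * √(c₂ * p) / 2 with hr
  have hsq : √(c₂ * p) ^ 2 = c₂ * p := Real.sq_sqrt (by positivity)
  have hr0 : 0 < r := by positivity
  have hgap : ∀ j, k ≤ j → h (x j ω) - optValue h S ≤ invSmoothingInv φ τ t₀
      ((c₁ * c₂ * p / 4 * ∑ i ∈ Finset.range (j + 1), α i : ℝ) : EReal) := by
    intro j hj
    refine (hω j ((le_max_left _ _).trans (hk.trans hj))).trans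
      (H.invSmoothingInv_anti hφ ht₀ (mul_nonneg (by positivity) (hs0 _)) ?_)
    have h1 := hN j ((le_max_right _ _).trans (hk.trans hj))
    rw [Finset.sum_range_succ]
    have h2 := hαA j
    nlinarith
  have hle : ∀ n, k ≤ n → ‖x k ω - x n ω‖ ≤ 1 / r * desingularization φ (invSmoothingInv φ τ t₀
      ((c₁ * c₂ * p / 4 * ∑ i ∈ Finset.range k, α i : ℝ) : EReal)) := by
    intro n hn
    have h1 := H.sum_Ico_le_desingularization hφ ht₀ hΦ halg.stepSize_pos
      (c := c₁ * c₂ * p / 4) (by positivity) hc₁ hr0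
      (by rw [hr, div_pow, mul_pow, hsq]; ring)
      (t := fun j => h (x j ω) - optValue h S) (fun j => (halg.gap_mem heb j ω).1)
      (δ := fun j => ‖x (j + 1) ω - x j ω‖) (fun j => halg.sq_step_le j ω) hgap hn
    refine le_trans ?_ h1
    have := dist_le_Ico_sum_dist (fun j => x j ω) hn
    simpa [dist_eq_norm, norm_sub_rev] using this
  have hlimit := le_of_tendsto (hx.const_sub (x k ω)).norm ((eventually_ge_atTop k).mono hle)
  refine hlimit.trans (mul_le_mul_of_nonneg_right ?_ ?_)
  · rw [hr, one_div_div]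
    gcongr
    norm_num
  · have hm := H.invSmoothingInv_coe_mem_Ioo hφ ht₀
      (mul_nonneg (by positivity : 0 ≤ c₁ * c₂ * p / 4) (hs0 k))
    simpa using H.monotoneOn_desingularization hΦ ⟨le_rfl, heb.τ_pos⟩ (Ioo_subset_Ico_self hm)
      hm.1.le

end IsMonotoneRandomizedAlgorithm

theorem mainTheorem1
    {Ω : Type*} [MeasurableSpace Ω] (μ : Measure Ω) [IsProbabilityMeasure μ] {d : ℕ}
    (x : ℕ → Ω → EuclideanSpace ℝ (Fin d)) (x₀ : EuclideanSpace ℝ (Fin d))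
    (S : Set (EuclideanSpace ℝ (Fin d))) (g h : EuclideanSpace ℝ (Fin d) → ℝ)
    (c₁ c₂ c₃ : ℝ) (α : ℕ → ℝ)
    (halg : IsMonotoneRandomizedAlgorithm μ x x₀ S g h c₁ c₂ c₃ α)
    (φ : ℝ → ℝ) (τ : ℝ) (heb : IsGlobalErrorBound S g h φ τ)
    (hφ : ¬ IntegrableNearZero τ (fun s => 1 / φ s))
    (t₀ : ℝ) (ht₀ : t₀ ∈ Ioo 0 τ)
    (p : ℝ) (hp : p = c₂ / (2 * c₃ - c₂))
    -- the standing condition on the step sizes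
    (αbar : ℝ) (hαbar : 0 < αbar) (hα_le : ∀ k, α k ≤ αbar)
    (hα_sum : Tendsto (fun k => ∑ i ∈ Finset.range k, α i) atTop atTop) :
    -- in-expectation rate of the optimality metric
    (∀ k, 1 ≤ k →
      Integrable (fun ω => h (x k ω) - optValue h S) μ ∧
      invSmoothing φ t₀ (h x₀ - optValue h S) +
          ((c₁ * c₂ * p / 4 * ∑ i ∈ Finset.range k, α i : ℝ) : EReal) ∈
        invSmoothingRange φ τ t₀ ∧
      ∫ ω, (h (x k ω) - optValue h S) ∂μ ≤
        Real.exp (-(p ^ 2 / (2 * αbar)) * ∑ i ∈ Finset.range k, α i) * (h x₀ - optValue h S) +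
        invSmoothingInv φ τ t₀
          (invSmoothing φ t₀ (h x₀ - optValue h S) +
            ((c₁ * c₂ * p / 4 * ∑ i ∈ Finset.range k, α i : ℝ) : EReal))) ∧
    -- almost-sure rate of the optimality metric
    (Summable (fun k => (α k / ∑ j ∈ Finset.range (k + 1), α j) ^ 2) →
      ∃ K₂ : Ω → ℕ, Measurable K₂ ∧ ∀ᵐ ω ∂μ, ∀ k, K₂ ω ≤ k →
        ((c₁ * c₂ * p / 3 * ∑ i ∈ Finset.range k, α i : ℝ) : EReal) ∈
          invSmoothingRange φ τ t₀ ∧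
        h (x k ω) - optValue h S ≤
          invSmoothingInv φ τ t₀
            ((c₁ * c₂ * p / 3 * ∑ i ∈ Finset.range k, α i : ℝ) : EReal)) ∧
    (IntegrableNearZero τ (fun s => 1 / √(φ s)) →
      ∃ xs : Ω → EuclideanSpace ℝ (Fin d), Measurable xs ∧
        -- convergence of the iterates, almost surely and in `L¹`, to a minimizer
        (∀ᵐ ω ∂μ, Tendsto (fun k => x k ω) atTop (𝓝 (xs ω))) ∧
        (∀ k, Integrable (x k) μ) ∧ Integrable xs μ ∧
        Tendsto (fun k => eLpNorm (x k - xs) 1 μ) atTop (𝓝 0) ∧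
        (∀ᵐ ω ∂μ, xs ω ∈ S ∧ IsMinOn h S (xs ω)) ∧
        -- in-expectation rate of the iterates
        (∀ k, Integrable (fun ω => h (x k ω) - optValue h S) μ ∧
          ∫ ω, ‖x k ω - xs ω‖ ∂μ ≤
            √c₃ / (c₁ * c₂) * desingularization φ (∫ ω, (h (x k ω) - optValue h S) ∂μ)) ∧
        -- almost-sure rate of the iterates
        (Summable (fun k => (α k / ∑ j ∈ Finset.range (k + 1), α j) ^ 2) →
          ∃ K₃ : Ω → ℕ, Measurable K₃ ∧ ∀ᵐ ω ∂μ, ∀ k, K₃ ω ≤ k →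
            ((c₁ * c₂ * p / 4 * ∑ i ∈ Finset.range k, α i : ℝ) : EReal) ∈
              invSmoothingRange φ τ t₀ ∧
            ‖x k ω - xs ω‖ ≤
              4 / (c₁ * √(c₂ * p)) *
                desingularization φ (invSmoothingInv φ τ t₀
                  ((c₁ * c₂ * p / 4 * ∑ i ∈ Finset.range k, α i : ℝ) : EReal)))) := by
  have hαpos := halg.stepSize_pos
  have hc₁ := halg.c₁_pos
  have hc₂ := halg.c₂_pos
  have hc₃ := halg.c₂_lt_c₃
  have H := heb.isErrorBoundFunction
  have hp0 : 0 < p := by rw [hp]; exact div_pos hc₂ (by linarith)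
  have hs0 : ∀ k, 0 ≤ ∑ i ∈ Finset.range k, α i := fun k =>
    Finset.sum_nonneg fun i _ => (hαpos i).le
  refine ⟨fun k _ => ⟨halg.integrable_gap heb k, halg.integral_gap_le heb hφ ht₀ hp hαbar hα_le k⟩,
    fun _ => ?_, fun hΦ => ?_⟩
  · obtain ⟨K, hK, hKle⟩ :=
      halg.exists_measurable_index_gap_le heb hφ ht₀ hp hαbar hα_le hα_sum
    exact ⟨K, hK, hKle.mono fun ω hω k hk => ⟨H.coe_mem_invSmoothingRange hφ ht₀
      (mul_nonneg (by positivity) (hs0 k)), hω k hk⟩⟩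
  · obtain ⟨xs, hxs, hlim⟩ := halg.exists_ae_tendsto heb hΦ
    have hgap := halg.ae_tendsto_gap heb hφ hαbar hα_le hα_sum
    have hle := halg.eLpNorm_sub_limit_le heb hΦ hlim
    have hsub : ∀ k, Integrable (x k - xs) μ := fun k => memLp_one_iff_integrable.1
      ⟨((halg.measurable_iterate k).sub hxs).aestronglyMeasurable,
        (hle k).trans_lt ENNReal.ofReal_lt_top⟩
    have hxsi : Integrable xs μ := by
      simpa using (halg.integrable_iterate 0).sub (hsub 0)
    refine ⟨xs, hxs, hlim, halg.integrable_iterate, hxsi, ?_, ?_,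
      fun k => ⟨halg.integrable_gap heb k, ?_⟩, fun _ => ?_⟩
    · refine tendsto_of_tendsto_of_tendsto_of_le_of_le tendsto_const_nhds ?_ (fun k => zero_le)
        hle
      have h1 := (halg.tendsto_integral_desingularization_gap heb hΦ hgap).const_mul
        (√c₃ / (c₁ * c₂))
      rw [mul_zero] at h1
      simpa [Function.comp_def] using (ENNReal.continuous_ofReal.tendsto 0).comp h1
    · filter_upwards [hlim, hgap] with ω h1 h2
      exact halg.mem_and_isMinOn_of_tendsto h1 h2
    · have h1 := hle k
      have h0 : 0 ≤ ∫ ω, desingularization φ (h (x k ω) - optValue h S) ∂μ :=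
        integral_nonneg (halg.desingularization_gap_nonneg heb hΦ k)
      rw [eLpNorm_one_eq_lintegral_enorm, ← ofReal_integral_norm_eq_lintegral_enorm (hsub k),
        ENNReal.ofReal_le_ofReal_iff (by positivity)] at h1
      exact h1.trans (mul_le_mul_of_nonneg_left (halg.integral_desingularization_gap_le heb hΦ k)
        (by positivity))
    · obtain ⟨K, hK, hKle⟩ := halg.exists_measurable_index_norm_sub_limit_le heb hφ hΦ ht₀ hp hαbar
        hα_le hα_sum hlim
      exact ⟨K, hK, hKle.mono fun ω hω k hk => ⟨H.coe_mem_invSmoothingRange hφ ht₀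
        (mul_nonneg (by positivity) (hs0 k)), hω k hk⟩⟩
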